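/- Let $m\ge 1$ and $d\ge 1$ be integers. For $a=(a_1,\dots,a_m)\in\mathbb{R}_{>0}^m$ let $$\mathcal{C}^m_d(a)=\Big\{z=(z_1,\dots,z_{m-1})\in\prod_{i=1}^{m-1}S^{d-1}\ \Big|\ \sum_{i=1}^{m-1}a_iz_i=a_m e_1\Big\},$$ where $e_1$ is the first vector of the standard basis of $\mathbb{R}^d$ and $S^{d-1}$ is the unit sphere of $\mathbb{R}^d$. The group $O(d-1)$, seen as the subgroup of $O(d)$ fixing $e_1$, acts on $\mathcal{C}^m_d(a)$ by $A\cdot(z_1,\dots,z_{m-1})=(Az_1,\dots,Az_{m-1})$, and $\mathcal{N}^m_d(a)=SO(d-1)\backslash\mathcal{C}^m_d(a)$. The element $a$ is called generic if $\mathcal{C}^m_1(a)=\emptyset$; then $\mathcal{C}^m_d(a)$ is a closed smooth submanifold of $(\mathbb{R}^d)^{m-1}$. A subset $J\subseteq\{1,\dots,m\}$ is called short if $\sum_{i\in J}a_i<\sum_{i\notin J}a_i$, and $\mathcal{S}_m(a)$ denotes the set of the short subsets that contain $m$, ordered by inclusion. **Lemma.** Let $a,a'\in\mathbb{R}_{>0}^m$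 be generic, and suppose that $\mathcal{S}_m(a)$ and $\mathcal{S}_m(a')$ are isomorphic as posets. Then: (i) $\mathcal{C}^m_d(a)$ and $\mathcal{C}^m_d(a')$ are $O(d-1)$-equivariantly diffeomorphic; (ii) $\mathcal{N}^m_d(a)$ and $\mathcal{N}^m_d(a')$ are diffeomorphic. Here a real function on an open set $U\subseteq\mathcal{N}^m_d(a)$ is called smooth if its pull-back to the preimage of $U$ in $\mathcal{C}^m_d(a)$ is smooth, and a diffeomorphism in (ii) is a homeomorphism under which the smooth functions on open sets correspond to each other. When $\mathcal{N}^m_d(a)$ and $\mathcal{N}^m_d(a')$ are smooth manifolds as quotients (in particular for $d=2,3$), this is the usual notion. -/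

import Mathlib

open scoped ContDiff

noncomputable section

namespace ChainPolygon

/-! ### Smooth maps on subsets of normed spaces -/

/-- A map `f` defined on a subset `X` of a normed space `V` is smooth at `x ∈ X` if, on some open
neighbourhood of `x` in `V`, it extends to a `C^∞` map. For an embedded submanifold `X` this is
smoothness at `x` in the sense of manifolds. -/
def SmoothAt {V W : Type*} [NormedAddCommGroup V] [NormedSpace ℝ V]
    [NormedAddCommGroup W] [NormedSpace ℝ W] {X : Set V} (f : X → W) (x : X) : Prop :=
  ∃ U : Set V, IsOpen U ∧ (x : V) ∈ U ∧
    ∃ F : V → W, ContDiffOn ℝ ∞ F U ∧ ∀ y : X, (y : V) ∈ U → F y = f y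

/-- A map between subsets of normed spaces is smooth if it is so at every point, as a map into the
ambient space of the target. -/
def Smooth {V W : Type*} [NormedAddCommGroup V] [NormedSpace ℝ V]
    [NormedAddCommGroup W] [NormedSpace ℝ W] {X : Set V} {Y : Set W} (f : X → Y) : Prop :=
  ∀ x : X, SmoothAt (fun y : X => (f y : W)) x

/-! ### Chain spaces -/

/-- The first vector of the standard basis of `ℝ^d`. -/
def e₁ (d : ℕ) [NeZero d] : EuclideanSpace ℝ (Fin d) := EuclideanSpace.single 0 1

/-- The chain space of `a = (a_1, …, a_m)`, with `m = n + 1`, as a subset of `(ℝ^d)^(m - 1)`. -/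
def chainSpace (d : ℕ) [NeZero d] {n : ℕ} (a : Fin (n + 1) → ℝ) :
    Set (Fin n → EuclideanSpace ℝ (Fin d)) :=
  {z | (∀ i, z i ∈ Metric.sphere (0 : EuclideanSpace ℝ (Fin d)) 1) ∧
    ∑ i : Fin n, a i.castSucc • z i = a (Fin.last n) • e₁ d}

/-- `a` is generic if it has no lined chain, that is, its chain space for `d = 1` is empty. -/
def Generic {n : ℕ} (a : Fin (n + 1) → ℝ) : Prop := chainSpace 1 a = ∅

/-! ### Short subsets -/

/-- `J ⊆ {1, …, m}` is short if the lengths over `J` add up to less than those over its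
complement. -/
def IsShort {n : ℕ} (a : Fin (n + 1) → ℝ) (J : Finset (Fin (n + 1))) : Prop :=
  ∑ i ∈ J, a i < ∑ i ∈ Jᶜ, a i

/-- The short subsets that contain the last index `m`. As a type it is ordered by inclusion. -/
def shortLast {n : ℕ} (a : Fin (n + 1) → ℝ) : Set (Finset (Fin (n + 1))) :=
  {J | IsShort a J ∧ Fin.last n ∈ J}

/-! ### The actions of `O(d - 1)` and `SO(d - 1)` -/

/-- `O(d - 1)`, as the subgroup of `O(d)` of the isometries that fix `e₁`. -/
def orthogonalSub (d : ℕ) [NeZero d] :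
    Subgroup (EuclideanSpace ℝ (Fin d) ≃ₗᵢ[ℝ] EuclideanSpace ℝ (Fin d)) where
  carrier := {A | A (e₁ d) = e₁ d}
  mul_mem' := by
    intro A B hA hB
    change A (B (e₁ d)) = e₁ d
    rw [show B (e₁ d) = e₁ d from hB]
    exact hA
  one_mem' := rfl
  inv_mem' := by
    intro A hA
    change A.symm (e₁ d) = e₁ d
    rw [LinearIsometryEquiv.symm_apply_eq]
    exact (show A (e₁ d) = e₁ d from hA).symm

/-- `SO(d - 1)`, as the subgroup of `O(d - 1)` of the elements of determinant `1`. -/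
def specialOrthogonalSub (d : ℕ) [NeZero d] : Subgroup (orthogonalSub d) where
  carrier := {A | LinearEquiv.det
    (A : EuclideanSpace ℝ (Fin d) ≃ₗᵢ[ℝ] EuclideanSpace ℝ (Fin d)).toLinearEquiv = 1}
  mul_mem' := by
    intro A B hA hB
    have h := map_mul LinearEquiv.det
      (A : EuclideanSpace ℝ (Fin d) ≃ₗᵢ[ℝ] EuclideanSpace ℝ (Fin d)).toLinearEquiv
      (B : EuclideanSpace ℝ (Fin d) ≃ₗᵢ[ℝ] EuclideanSpace ℝ (Fin d)).toLinearEquiv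
    rw [hA, hB, one_mul] at h
    exact h
  one_mem' := map_one LinearEquiv.det
  inv_mem' := by
    intro A hA
    have h := map_inv LinearEquiv.det
      (A : EuclideanSpace ℝ (Fin d) ≃ₗᵢ[ℝ] EuclideanSpace ℝ (Fin d)).toLinearEquiv
    rw [hA, inv_one] at h
    exact h

/-- `O(d - 1)` acts on the chain space by `A • (z_1, …, z_{m-1}) = (A z_1, …, A z_{m-1})`. -/
instance (d : ℕ) [NeZero d] {n : ℕ} (a : Fin (n + 1) → ℝ) :
    MulAction (orthogonalSub d) (chainSpace d a) where
  smul A z := ⟨fun i => A.1 (z.1 i), by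
    refine ⟨fun i => ?_, ?_⟩
    · have h := z.2.1 i
      rw [mem_sphere_zero_iff_norm] at h ⊢
      rw [LinearIsometryEquiv.norm_map, h]
    · have h := congrArg A.1 z.2.2
      rw [map_sum] at h
      simp only [map_smul] at h
      rw [h, show A.1 (e₁ d) = e₁ d from A.2]⟩
  one_smul _ := rfl
  mul_smul _ _ _ := rfl

/-- The chain spaces of `a` and `a'` are `O(d - 1)`-equivariantly diffeomorphic. -/
def ChainsEquivariantlyDiffeomorphic (d : ℕ) [NeZero d] {n : ℕ} (a a' : Fin (n + 1) → ℝ) : Prop :=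
  ∃ Ψ : chainSpace d a ≃ chainSpace d a', Smooth Ψ ∧ Smooth Ψ.symm ∧
    ∀ (A : orthogonalSub d) (z : chainSpace d a), Ψ (A • z) = A • Ψ z

/-! ### Polygon spaces -/

/-- The polygon space `SO(d - 1) \ chainSpace d a`; it carries the quotient topology. -/
abbrev PolygonSpace (d : ℕ) [NeZero d] {n : ℕ} (a : Fin (n + 1) → ℝ) : Type :=
  Quotient (MulAction.orbitRel (specialOrthogonalSub d) (chainSpace d a))

/-- The projection from the chain space to the polygon space. -/
def proj (d : ℕ) [NeZero d] {n : ℕ} (a : Fin (n + 1) → ℝ) (z : chainSpace d a) :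
    PolygonSpace d a := Quotient.mk _ z

/-- The sheaf of smooth functions of the quotient: a real function is smooth on `U` if its
pull-back to the chain space is smooth on the preimage of `U`. -/
def SmoothFunctionOn {d : ℕ} [NeZero d] {n : ℕ} {a : Fin (n + 1) → ℝ}
    (U : Set (PolygonSpace d a)) (f : PolygonSpace d a → ℝ) : Prop :=
  ∀ z : chainSpace d a, proj d a z ∈ U → SmoothAt (fun w => f (proj d a w)) z

/-- The polygon spaces of `a` and `a'` are diffeomorphic: some homeomorphism identifies their
sheaves of smooth functions. (Where the quotients are smooth manifolds, as for `d = 2, 3`, these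
homeomorphisms are exactly the diffeomorphisms of manifolds; for larger `d` the quotient may be
singular.) -/
def PolygonsDiffeomorphic (d : ℕ) [NeZero d] {n : ℕ} (a a' : Fin (n + 1) → ℝ) : Prop :=
  ∃ h : PolygonSpace d a ≃ₜ PolygonSpace d a',
    ∀ (U : Set (PolygonSpace d a')), IsOpen U → ∀ f : PolygonSpace d a' → ℝ,
      SmoothFunctionOn U f ↔ SmoothFunctionOn (h ⁻¹' U) (f ∘ h)

end ChainPolygon

end

/-! A chain followed by `-e₁` is a closed polygon: unit vectors with weights `a` and weighted sum
zero. Regard its edges as points on the boundary sphere of hyperbolic space. Being closed means that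
the base point is critical for the averaged Busemann function. For generic weights it is then the
strict minimum (`Unlined.sum_log_pos`). For any positive weights `b`, if no point of the sphere
carries half of the total weight, the averaged function is proper (`tendsto_sum_log`) and so has a
minimum, the conformal barycentre (`exists_barycentre`). The similarities `y ↦ r • (y + v)` in
stereographic coordinates fix the pole `-e₁` and act simply transitively on hyperbolic space. One of
them therefore moves the barycentre to the base point, closing the configuration for `b` and keeping
the last edge `-e₁`; for generic `b` it is unique (`moebius_param_unique`).

Coinciding edges of a generic closed polygon form a short set. If `a` and `b` have the same short
sets containing `m`, then by complements they have the same short sets, so polygons closed for one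
can be closed for the other (`closable_of_short_iff`). Uniqueness makes the two passages mutually
inverse and equivariant; the implicit function theorem makes them smooth.

The short sets containing `m`, with `m` removed, form a simplicial complex, so an isomorphism of the
posets is induced by a permutation fixing `m` (`exists_perm_of_orderIso`). Relabelling the edges
reduces to the previous case. Equivariance gives the statement on quotients. -/

noncomputable section

namespace ChainPolygon

/-! ### Möbius maps of the sphere that fix a pole -/

section Moebius

variable {E : Type*} [NormedAddCommGroup E] [InnerProductSpace ℝ E]

local notation "⟪" x ", " y "⟫" => inner ℝ x y

/-- The conformal denominator of the Möbius map `moebius e p` at `z`. -/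
def moebiusDenom (e p z : E) : ℝ :=
  ((1 + ⟪e, z⟫) + ⟪e, p⟫ ^ 2 * ((1 - ⟪e, z⟫) + 2 * (⟪p, z⟫ - ⟪e, p⟫ * ⟪e, z⟫)
    + (‖p‖ ^ 2 - ⟪e, p⟫ ^ 2) * (1 + ⟪e, z⟫))) / 2

/-- For a unit vector `e` and `p = r • e + b` with `r > 0` and `b` orthogonal to `e`, the map of
the unit sphere that is the similarity `y ↦ r • (y + b)` in stereographic coordinates from the
pole `-e`. -/
def moebius (e p z : E) : E :=
  -e + (moebiusDenom e p z)⁻¹ • ((1 + ⟪e, z⟫) • e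
    + ⟪e, p⟫ • (z - ⟪e, z⟫ • e + (1 + ⟪e, z⟫) • (p - ⟪e, p⟫ • e)))

/-- The parameter of the composition of `moebius e p` followed by `moebius e q`. -/
def moebiusComp (e q p : E) : E :=
  (⟪e, q⟫ * ⟪e, p⟫) • e + (p - ⟪e, p⟫ • e) + ⟪e, p⟫⁻¹ • (q - ⟪e, q⟫ • e)

/-- The parameter of the inverse of `moebius e p`. -/
def moebiusInv (e p : E) : E := ⟪e, p⟫⁻¹ • e - ⟪e, p⟫ • (p - ⟪e, p⟫ • e)

variable {e : E}

theorem inner_moebiusComp (he : ‖e‖ = 1) (q p : E) :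
    ⟪e, moebiusComp e q p⟫ = ⟪e, q⟫ * ⟪e, p⟫ := by
  simp [moebiusComp, inner_add_right, inner_sub_right, inner_smul_right, he]

theorem inner_moebiusInv (he : ‖e‖ = 1) (p : E) : ⟪e, moebiusInv e p⟫ = ⟪e, p⟫⁻¹ := by
  simp [moebiusInv, inner_sub_right, inner_smul_right, he]

theorem moebiusComp_inv (he : ‖e‖ = 1) {p : E} (hp : ⟪e, p⟫ ≠ 0) :
    moebiusComp e (moebiusInv e p) p = e := by
  rw [moebiusComp, inner_moebiusInv he, inv_mul_cancel₀ hp, one_smul, moebiusInv,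
    sub_sub_cancel_left, smul_neg, smul_smul, inv_mul_cancel₀ hp, one_smul]
  abel

theorem eq_of_moebiusComp_inv_eq (he : ‖e‖ = 1) {p q : E} (hp : ⟪e, p⟫ ≠ 0)
    (h : moebiusComp e q (moebiusInv e p) = e) : q = p := by
  have h1 : ⟪e, q⟫ = ⟪e, p⟫ := by
    have := congrArg (fun x => ⟪e, x⟫) h
    simp only [inner_moebiusComp he, inner_moebiusInv he, real_inner_self_eq_norm_sq, he] at this
    field_simp at this
    simpa using this
  rw [moebiusComp, inner_moebiusInv he, h1, mul_inv_cancel₀ hp, one_smul, moebiusInv,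
    sub_sub_cancel_left, inv_inv, add_assoc, add_eq_left, ← smul_neg, ← smul_add,
    smul_eq_zero_iff_right hp] at h
  rw [← sub_eq_zero, ← h]
  abel

theorem moebiusDenom_self (he : ‖e‖ = 1) (z : E) : moebiusDenom e e z = 1 := by
  simp [moebiusDenom, he]

theorem moebius_self (he : ‖e‖ = 1) (z : E) : moebius e e z = z := by
  rw [moebius, moebiusDenom_self he]
  simp only [real_inner_self_eq_norm_sq, he]
  module

theorem moebius_neg_pole (he : ‖e‖ = 1) (p : E) : moebius e p (-e) = -e := by
  simp [moebius, he]

theorem inner_moebius (he : ‖e‖ = 1) (p z : E) :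
    ⟪e, moebius e p z⟫ = -1 + (moebiusDenom e p z)⁻¹ * (1 + ⟪e, z⟫) := by
  simp [moebius, inner_add_right, inner_sub_right, inner_smul_right, he]

theorem moebius_sub_smul (he : ‖e‖ = 1) (p z : E) :
    moebius e p z - ⟪e, moebius e p z⟫ • e = ((moebiusDenom e p z)⁻¹ * ⟪e, p⟫) •
      (z - ⟪e, z⟫ • e + (1 + ⟪e, z⟫) • (p - ⟪e, p⟫ • e)) := by
  rw [inner_moebius he, moebius]
  module

theorem norm_sub_smul_sq (he : ‖e‖ = 1) (p : E) :
    ‖p - ⟪e, p⟫ • e‖ ^ 2 = ‖p‖ ^ 2 - ⟪e, p⟫ ^ 2 := by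
  rw [norm_sub_sq_real, norm_smul, he, inner_smul_right, real_inner_comm, Real.norm_eq_abs,
    mul_one, sq_abs]
  ring

/-- Chain rule: by `inner_moebius`, away from `-e` the denominator is the ratio of `1 + ⟪e, z⟫`
before and after the map. This cocycle identity later makes logarithms cancel. -/
theorem moebiusDenom_mul (he : ‖e‖ = 1) (q : E) {p z : E} (hp : ⟪e, p⟫ ≠ 0)
    (hD : moebiusDenom e p z ≠ 0) :
    moebiusDenom e q (moebius e p z) * moebiusDenom e p z
      = moebiusDenom e (moebiusComp e q p) z := by
  have h1 : ‖moebiusComp e q p‖ ^ 2 = (⟪e, q⟫ * ⟪e, p⟫) ^ 2 + (‖p‖ ^ 2 - ⟪e, p⟫ ^ 2)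
      + 2 * ⟪e, p⟫⁻¹ * (⟪q, p⟫ - ⟪e, q⟫ * ⟪e, p⟫)
      + ⟪e, p⟫⁻¹ ^ 2 * (‖q‖ ^ 2 - ⟪e, q⟫ ^ 2) := by
    simp only [← real_inner_self_eq_norm_sq, moebiusComp, inner_add_right, inner_sub_right,
      inner_smul_right, inner_add_left, inner_sub_left, real_inner_smul_left]
    simp only [real_inner_comm e p, real_inner_comm e q, real_inner_comm p q,
      real_inner_self_eq_norm_sq, he]
    ring
  have h2 : ⟪moebiusComp e q p, z⟫ = ⟪e, q⟫ * ⟪e, p⟫ * ⟪e, z⟫ + (⟪p, z⟫ - ⟪e, p⟫ * ⟪e, z⟫)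
      + ⟪e, p⟫⁻¹ * (⟪q, z⟫ - ⟪e, q⟫ * ⟪e, z⟫) := by
    simp only [moebiusComp, inner_add_left, inner_sub_left, real_inner_smul_left]
  have h3 : ⟪q, moebius e p z⟫ = - ⟪e, q⟫ + (moebiusDenom e p z)⁻¹ * ((1 + ⟪e, z⟫) * ⟪e, q⟫
      + ⟪e, p⟫ * (⟪q, z⟫ - ⟪e, z⟫ * ⟪e, q⟫ + (1 + ⟪e, z⟫) * (⟪q, p⟫ - ⟪e, p⟫ * ⟪e, q⟫))) := by
    simp only [moebius, inner_add_right, inner_sub_right, inner_smul_right, inner_neg_right,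
      real_inner_comm e q]
  have h4 : moebiusDenom e p z = ((1 + ⟪e, z⟫) + ⟪e, p⟫ ^ 2 * ((1 - ⟪e, z⟫)
    + 2 * (⟪p, z⟫ - ⟪e, p⟫ * ⟪e, z⟫) + (‖p‖ ^ 2 - ⟪e, p⟫ ^ 2) * (1 + ⟪e, z⟫))) / 2 := rfl
  rw [moebiusDenom.eq_def e q, moebiusDenom.eq_def e (moebiusComp e q p), h1, h2, h3,
    inner_moebius he, inner_moebiusComp he]
  generalize moebiusDenom e p z = D at *
  field_simp
  rw [h4]
  ring

theorem moebius_moebius (he : ‖e‖ = 1) (q : E) {p z : E} (hp : ⟪e, p⟫ ≠ 0)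
    (hD : moebiusDenom e p z ≠ 0) :
    moebius e q (moebius e p z) = moebius e (moebiusComp e q p) z := by
  have h := moebiusDenom_mul he q hp hD
  have h' : (moebiusDenom e q (moebius e p z))⁻¹
      = (moebiusDenom e (moebiusComp e q p) z)⁻¹ * moebiusDenom e p z := by
    rw [← h]; field_simp
  rw [moebius, moebius_sub_smul he, inner_moebius he, h', moebius.eq_def e (moebiusComp e q p) z,
    inner_moebiusComp he, moebiusComp]
  generalize moebiusDenom e p z = D at *
  match_scalars <;> field_simp <;> ring

theorem norm_moebius (he : ‖e‖ = 1) {p z : E} (hz : ‖z‖ = 1) (hD : moebiusDenom e p z ≠ 0) :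
    ‖moebius e p z‖ = 1 := by
  have h4 : moebiusDenom e p z = ((1 + ⟪e, z⟫) + ⟪e, p⟫ ^ 2 * ((1 - ⟪e, z⟫)
    + 2 * (⟪p, z⟫ - ⟪e, p⟫ * ⟪e, z⟫) + (‖p‖ ^ 2 - ⟪e, p⟫ ^ 2) * (1 + ⟪e, z⟫))) / 2 := rfl
  rw [← sq_eq_sq₀ (norm_nonneg _) zero_le_one, ← real_inner_self_eq_norm_sq, moebius]
  generalize moebiusDenom e p z = D at *
  simp only [inner_add_right, inner_sub_right, inner_neg_right, inner_neg_left,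
      inner_smul_right, inner_add_left, inner_sub_left, real_inner_smul_left]
  simp only [real_inner_comm e p, real_inner_comm e z, real_inner_comm p z,
      real_inner_self_eq_norm_sq, he, hz]
  field_simp
  rw [h4]
  ring

theorem moebius_map (A : E ≃ₗᵢ[ℝ] E) (hA : A e = e) (p z : E) :
    moebius e (A p) (A z) = A (moebius e p z) := by
  have h : ∀ x, ⟪e, A x⟫ = ⟪e, x⟫ := fun x => by
    conv_lhs => rw [← hA]
    exact A.inner_map_map e x
  simp only [moebius, moebiusDenom, h, A.inner_map_map, A.norm_map, map_add, map_neg, map_smul,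
    map_sub, hA]

/-! ### The hyperboloid model -/

theorem norm_lt_sqrt_one_add_sq {E : Type*} [NormedAddCommGroup E] (w : E) : ‖w‖ < √(1 + ‖w‖ ^ 2) :=
  Real.lt_sqrt_of_sq_lt (by linarith)

/-- This is the Lorentz pairing of the hyperboloid point over `w` with the null vector `(1, z)`; its
logarithm is the Busemann function at `z`. -/
theorem sqrt_sub_inner_pos (w : E) {z : E} (hz : ‖z‖ = 1) : 0 < √(1 + ‖w‖ ^ 2) - ⟪w, z⟫ := by
  have h1 := norm_lt_sqrt_one_add_sq w
  have h2 := real_inner_le_norm w z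
  rw [hz, mul_one] at h2
  linarith

/-- A Möbius map fixing the pole is determined by the point of the hyperboloid that it moves to the
base point. -/
theorem exists_moebiusDenom_eq (he : ‖e‖ = 1) {p : E} (hp : 0 < ⟪e, p⟫) :
    ∃ w : E, ⟪e, p⟫ = √(1 + ‖w‖ ^ 2) + ⟪w, e⟫ ∧
      (∀ z, moebiusDenom e p z = ⟪e, p⟫ * (√(1 + ‖w‖ ^ 2) - ⟪w, z⟫)) ∧ (w = 0 → p = e) := by
  set r := ⟪e, p⟫ with hr
  -- The denominator is affine in `z`; `w` is read off from its linear part `-r • w`, and `c` is the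
  -- component along `e`.
  set c := ((r ^ 2 - 1 - r ^ 2 * (‖p‖ ^ 2 - r ^ 2)) / (2 * r)) with hc
  set w : E := c • e - r • (p - r • e) with hw
  have hwe : ⟪w, e⟫ = c := by
    rw [real_inner_comm, hw, inner_sub_right, inner_smul_right, inner_smul_right, inner_sub_right,
      inner_smul_right, ← hr, real_inner_self_eq_norm_sq, he]
    ring
  have hnw : 1 + ‖w‖ ^ 2 = ((r ^ 2 + 1 + r ^ 2 * (‖p‖ ^ 2 - r ^ 2)) / (2 * r)) ^ 2 := by
    rw [hw, ← real_inner_self_eq_norm_sq]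
    simp only [inner_sub_right, inner_smul_right, inner_sub_left, real_inner_smul_left]
    simp only [real_inner_comm e p, ← hr, real_inner_self_eq_norm_sq, he, hc]
    field_simp
    ring
  have hs : √(1 + ‖w‖ ^ 2) = (r ^ 2 + 1 + r ^ 2 * (‖p‖ ^ 2 - r ^ 2)) / (2 * r) := by
    rw [hnw, Real.sqrt_sq]
    rw [hr, ← norm_sub_smul_sq he]
    positivity
  refine ⟨w, ?_, fun z => ?_, fun h0 => ?_⟩
  · rw [hs, hwe, hc]; field_simp; ring
  · rw [hs, hw, moebiusDenom, ← hr]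
    simp only [inner_sub_left, real_inner_smul_left, hc]
    field_simp
    ring
  · have hc0 : c = 0 := by rw [← hwe, h0, inner_zero_left]
    have hr1 : r = 1 := by
      have := hs
      rw [h0, norm_zero, zero_pow two_ne_zero, add_zero, Real.sqrt_one] at this
      have h2 : 1 + c = r := by rw [this, hc]; field_simp; ring
      rw [← h2, hc0, add_zero]
    rw [hc0, zero_smul, zero_sub, hr1, one_smul, one_smul, h0, neg_sub, eq_comm, sub_eq_zero] at hw
    exact hw.symm

theorem moebiusDenom_pos (he : ‖e‖ = 1) {p z : E} (hp : 0 < ⟪e, p⟫) (hz : ‖z‖ = 1) :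
    0 < moebiusDenom e p z := by
  obtain ⟨w, -, h, -⟩ := exists_moebiusDenom_eq he hp
  rw [h]
  exact mul_pos hp (sqrt_sub_inner_pos w hz)

/-- Transitivity on the hyperboloid: the formulas of `exists_moebiusDenom_eq` are solved for `p`,
with `r` the sum of the height of `w` and its component along `e`. -/
theorem exists_moebius_eq (he : ‖e‖ = 1) (w : E) : ∃ p : E, 0 < ⟪e, p⟫ ∧ ∀ z,
    moebius e p z = -e + (√(1 + ‖w‖ ^ 2) - ⟪w, z⟫)⁻¹ • (z - ⟪e, z⟫ • e +
      ((1 + ⟪e, z⟫) * (√(1 + ‖w‖ ^ 2) + ⟪w, e⟫)⁻¹) • (e - w + ⟪w, e⟫ • e)) := by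
  set α := √(1 + ‖w‖ ^ 2) with hα
  have hα2 : α ^ 2 = 1 + ‖w‖ ^ 2 := Real.sq_sqrt (by positivity)
  set c := ⟪w, e⟫ with hc
  set r := α + c with hr
  have hr0 : 0 < r := by
    have := sqrt_sub_inner_pos w (z := -e) (by rwa [norm_neg])
    rw [inner_neg_right] at this
    linarith
  set p : E := r • e - r⁻¹ • (w - c • e) with hp
  have hep : ⟪e, p⟫ = r := by
    simp [hp, inner_sub_right, inner_smul_right, he, hc, real_inner_comm]
  have hD : ∀ z, moebiusDenom e p z = r * (α - ⟪w, z⟫) := fun z => by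
    have h1 : ‖p‖ ^ 2 = r ^ 2 + r⁻¹ ^ 2 * (‖w‖ ^ 2 - c ^ 2) := by
      rw [hp, ← real_inner_self_eq_norm_sq]
      simp only [inner_sub_right, inner_smul_right, inner_sub_left, real_inner_smul_left]
      simp only [real_inner_comm w e, ← hc, real_inner_self_eq_norm_sq, he]
      ring
    have h2 : ⟪p, z⟫ = r * ⟪e, z⟫ - r⁻¹ * (⟪w, z⟫ - c * ⟪e, z⟫) := by
      simp only [hp, inner_sub_left, real_inner_smul_left]
    rw [moebiusDenom, hep, h1, h2]
    have h3 : ‖w‖ ^ 2 = α ^ 2 - 1 := by linarith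
    have h4 : c = r - α := by rw [hr]; ring
    rw [h3, h4]
    field_simp
    ring
  refine ⟨p, hep ▸ hr0, fun z => ?_⟩
  rw [moebius, hD, hep, mul_inv, hp]
  match_scalars <;> field_simp
  ring

end Moebius

/-! ### Closed polygons and conformal barycentres -/

section Barycentre

variable {E : Type*} [NormedAddCommGroup E] [InnerProductSpace ℝ E]
  {ι : Type*} [Fintype ι] [DecidableEq ι]

local notation "⟪" x ", " y "⟫" => inner ℝ x y

/-- Families of unit vectors, weighted by `a`, that add up to zero. -/
def closedPolygons (E : Type*) [NormedAddCommGroup E] [InnerProductSpace ℝ E]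
    {ι : Type*} [Fintype ι] (a : ι → ℝ) : Set (ι → E) :=
  {z | (∀ i, ‖z i‖ = 1) ∧ ∑ i, a i • z i = 0}

/-- No subset of the weights makes up exactly half of the total. -/
def Unlined (a : ι → ℝ) : Prop := ∀ J : Finset ι, ∑ i ∈ J, a i ≠ ∑ i ∈ Jᶜ, a i

/-- Otherwise all edges are parallel to `w`, and closedness splits the total weight in half
according to direction. -/
theorem Unlined.exists_abs_inner_lt {a : ι → ℝ} (ha : Unlined a) {z : ι → E}
    (hz : z ∈ closedPolygons E a) {w : E} (hw : w ≠ 0) : ∃ i, |⟪w, z i⟫| < ‖w‖ := by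
  by_contra! h
  have hw' : ‖w‖ ≠ 0 := norm_ne_zero_iff.2 hw
  have h1 : ∀ i, |⟪w, z i⟫| = ‖w‖ := fun i => le_antisymm (by
    have := abs_real_inner_le_norm w (z i)
    rwa [hz.1 i, mul_one] at this) (h i)
  refine ha (Finset.univ.filter fun i => ⟪w, z i⟫ = ‖w‖) ?_
  have h2 : ∑ i, a i * ⟪w, z i⟫ = 0 := by
    have := congrArg (fun x => ⟪w, x⟫) hz.2
    simpa [inner_sum, inner_smul_right] using this
  rw [← Finset.sum_filter_add_sum_filter_not _ (fun i => ⟪w, z i⟫ = ‖w‖)] at h2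
  rw [Finset.compl_filter]
  have h3 : ∑ i with ⟪w, z i⟫ = ‖w‖, a i * ⟪w, z i⟫ = (∑ i with ⟪w, z i⟫ = ‖w‖, a i) * ‖w‖ := by
    rw [Finset.sum_mul]
    refine Finset.sum_congr rfl fun i hi => ?_
    rw [(Finset.mem_filter.1 hi).2]
  have h4 : ∑ i with ¬⟪w, z i⟫ = ‖w‖, a i * ⟪w, z i⟫
      = -((∑ i with ¬⟪w, z i⟫ = ‖w‖, a i) * ‖w‖) := by
    rw [Finset.sum_mul, ← Finset.sum_neg_distrib]
    refine Finset.sum_congr rfl fun i hi => ?_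
    rcases eq_or_eq_neg_of_abs_eq (h1 i) with h | h
    · exact absurd h (Finset.mem_filter.1 hi).2
    · rw [h, mul_neg]
  rw [h3, h4, ← sub_eq_add_neg, ← sub_mul] at h2
  exact sub_eq_zero.1 ((mul_eq_zero.1 h2).resolve_right hw')

theorem sqrt_sub_mul_sqrt_add {E : Type*} [NormedAddCommGroup E] (w : E) :
    (√(1 + ‖w‖ ^ 2) - ‖w‖) * (√(1 + ‖w‖ ^ 2) + ‖w‖) = 1 := by
  have : √(1 + ‖w‖ ^ 2) ^ 2 = 1 + ‖w‖ ^ 2 := Real.sq_sqrt (by positivity)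
  linear_combination this

/-- The Busemann functions of the hyperbolic space lie above their chords. -/
theorem neg_log_mul_inner_le {w z : E} (hw : w ≠ 0) (hz : ‖z‖ = 1) :
    -(Real.log (√(1 + ‖w‖ ^ 2) + ‖w‖) * ⟪w, z⟫) ≤ ‖w‖ * Real.log (√(1 + ‖w‖ ^ 2) - ⟪w, z⟫) ∧
    (|⟪w, z⟫| < ‖w‖ → -(Real.log (√(1 + ‖w‖ ^ 2) + ‖w‖) * ⟪w, z⟫)
      < ‖w‖ * Real.log (√(1 + ‖w‖ ^ 2) - ⟪w, z⟫)) := by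
  have hw' : 0 < ‖w‖ := norm_pos_iff.2 hw
  have hle : |⟪w, z⟫| ≤ ‖w‖ := by
    have := abs_real_inner_le_norm w z
    rwa [hz, mul_one] at this
  have hlt := norm_lt_sqrt_one_add_sq w
  have hprod := sqrt_sub_mul_sqrt_add w
  generalize √(1 + ‖w‖ ^ 2) = α at *
  generalize ⟪w, z⟫ = c at *
  have hlog : Real.log (α - ‖w‖) = -Real.log (α + ‖w‖) := by
    rw [← Real.log_inv, eq_inv_of_mul_eq_one_left hprod]
  generalize hs : ‖w‖ = s at *
  -- `α - c` is a convex combination of `α - s` and `α + s`, whose logarithms are opposite;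
  -- concavity of `log` gives the bound.
  have hcomb : ((s + c) / (2 * s)) • (α - s) + ((s - c) / (2 * s)) • (α + s) = α - c := by
    simp only [smul_eq_mul]; field_simp; ring
  have hval : s * (((s + c) / (2 * s)) • Real.log (α - s) + ((s - c) / (2 * s)) • Real.log (α + s))
      = -(Real.log (α + s) * c) := by
    rw [hlog]; simp only [smul_eq_mul]; field_simp; ring
  rw [← hval, ← hcomb]
  have m1 : α - s ∈ Set.Ioi (0 : ℝ) := sub_pos.2 hlt
  have m2 : α + s ∈ Set.Ioi (0 : ℝ) := Set.mem_Ioi.2 (by linarith)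
  have hone : (s + c) / (2 * s) + (s - c) / (2 * s) = 1 := by field_simp; ring
  rw [abs_le] at hle
  refine ⟨mul_le_mul_of_nonneg_left (strictConcaveOn_log_Ioi.concaveOn.2 m1 m2
    (div_nonneg (by linarith) (by linarith)) (div_nonneg (by linarith) (by linarith)) hone) hw'.le,
    fun h => ?_⟩
  rw [abs_lt] at h
  exact mul_lt_mul_of_pos_left (strictConcaveOn_log_Ioi.2 m1 m2 (by linarith)
    (div_pos (by linarith) (by linarith)) (div_pos (by linarith) (by linarith)) hone) hw'

/-- The chord bounds are linear in `z i`, so their weighted sum vanishes on a closed polygon; an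
edge not parallel to `w` makes the inequality strict. -/
theorem Unlined.sum_log_pos {a : ι → ℝ} (ha : Unlined a) (ha0 : ∀ i, 0 < a i) {z : ι → E}
    (hz : z ∈ closedPolygons E a) {w : E} (hw : w ≠ 0) :
    0 < ∑ i, a i * Real.log (√(1 + ‖w‖ ^ 2) - ⟪w, z i⟫) := by
  obtain ⟨j, hj⟩ := ha.exists_abs_inner_lt hz hw
  have h2 : ∑ i, a i * ⟪w, z i⟫ = 0 := by
    have := congrArg (fun x => ⟪w, x⟫) hz.2
    simpa [inner_sum, inner_smul_right] using this
  refine pos_of_mul_pos_right (a := ‖w‖) ?_ (norm_nonneg _)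
  calc (0 : ℝ) = ∑ i, a i * -(Real.log (√(1 + ‖w‖ ^ 2) + ‖w‖) * ⟪w, z i⟫) := by
        rw [← mul_zero (-Real.log (√(1 + ‖w‖ ^ 2) + ‖w‖)), ← h2, Finset.mul_sum]
        exact Finset.sum_congr rfl fun i _ => by ring
    _ < ∑ i, a i * (‖w‖ * Real.log (√(1 + ‖w‖ ^ 2) - ⟪w, z i⟫)) :=
        Finset.sum_lt_sum
          (fun i _ => mul_le_mul_of_nonneg_left (neg_log_mul_inner_le hw (hz.1 i)).1 (ha0 i).le)
          ⟨j, Finset.mem_univ _,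
            mul_lt_mul_of_pos_left ((neg_log_mul_inner_le hw (hz.1 j)).2 hj) (ha0 j)⟩
    _ = _ := by
        rw [Finset.mul_sum]
        exact Finset.sum_congr rfl fun i _ => by ring

/-- Both points have squared distance less than `2 * δ` from `w / ‖w‖`; the parallelogram law
doubles the sum of these. -/
theorem norm_sub_sq_lt_of_inner_gt {w x y : E} {δ : ℝ} (hw : w ≠ 0) (hx : ‖x‖ = 1) (hy : ‖y‖ = 1)
    (hwx : (1 - δ) * ‖w‖ < ⟪w, x⟫) (hwy : (1 - δ) * ‖w‖ < ⟪w, y⟫) : ‖x - y‖ ^ 2 < 8 * δ := by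
  have hw' : 0 < ‖w‖ := norm_pos_iff.2 hw
  have key : ∀ v : E, ‖v‖ = 1 → (1 - δ) * ‖w‖ < ⟪w, v⟫ → ‖v - ‖w‖⁻¹ • w‖ ^ 2 < 2 * δ := by
    intro v hv h
    rw [norm_sub_sq_real, norm_smul, norm_inv, norm_norm, inv_mul_cancel₀ hw'.ne', hv,
      inner_smul_right, real_inner_comm]
    have : 1 - δ < ‖w‖⁻¹ * ⟪w, v⟫ := by
      rw [inv_mul_eq_div, lt_div_iff₀ hw']; exact h
    linarith
  have h1 := key x hx hwx
  have h2 := key y hy hwy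
  have h3 := parallelogram_law_with_norm ℝ (x - ‖w‖⁻¹ • w) (y - ‖w‖⁻¹ • w)
  rw [sub_sub_sub_cancel_right] at h3
  nlinarith [mul_self_nonneg ‖x - ‖w‖⁻¹ • w + (y - ‖w‖⁻¹ • w)‖]

/-- If no point carries half of the weight, the averaged Busemann function is proper. -/
theorem tendsto_sum_log [ProperSpace E] {a : ι → ℝ} (ha0 : ∀ i, 0 < a i) {z : ι → E}
    (hz : ∀ i, ‖z i‖ = 1)
    (hs : ∀ J : Finset ι, (∀ i ∈ J, ∀ j ∈ J, z i = z j) → ∑ i ∈ J, a i < ∑ i ∈ Jᶜ, a i) :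
    Filter.Tendsto (fun w : E => ∑ i, a i * Real.log (√(1 + ‖w‖ ^ 2) - ⟪w, z i⟫))
      (Filter.cocompact E) Filter.atTop := by
  classical
  have hs' : ∀ j, ∑ i with z i = z j, a i < ∑ i with z i ≠ z j, a i := fun j => by
    rw [← Finset.compl_filter]
    exact hs _ fun i hi k hk => (Finset.mem_filter.1 hi).2.trans (Finset.mem_filter.1 hk).2.symm
  -- `δ` lies below every weight gap, and is so small that a cap of size `δ` contains at most one of
  -- the distinct points.
  obtain ⟨δ, ⟨hδ1, hδ2, hδ3⟩, hδ0⟩ : ∃ δ : ℝ, (δ < 1 ∧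
      (∀ j, δ < ∑ i with z i ≠ z j, a i - ∑ i with z i = z j, a i) ∧
      ∀ i j, z i ≠ z j → δ < ‖z i - z j‖ ^ 2 / 8) ∧ 0 < δ := by
    refine Filter.Eventually.exists (f := nhdsWithin (0 : ℝ) (Set.Ioi 0))
      (Filter.Eventually.and (Filter.Eventually.filter_mono nhdsWithin_le_nhds ?_)
        self_mem_nhdsWithin)
    refine (eventually_lt_nhds one_pos).and ((Filter.eventually_all.2 fun j =>
      eventually_lt_nhds (sub_pos.2 (hs' j))).and ?_)
    refine Filter.eventually_all.2 fun i => Filter.eventually_all.2 fun j => ?_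
    by_cases h : z i = z j
    · exact Filter.Eventually.of_forall fun _ h' => absurd h h'
    · have : 0 < ‖z i - z j‖ ^ 2 / 8 := by
        have := norm_pos_iff.2 (sub_ne_zero.2 h)
        positivity
      filter_upwards [eventually_lt_nhds this] with x hx _ using hx
  obtain ⟨i₀⟩ : Nonempty ι := by
    by_contra h
    rw [not_nonempty_iff] at h
    simpa using hs ∅
  have hlogδ : Real.log δ < 0 := Real.log_neg hδ0 hδ1
  have hlog3 : 0 < Real.log 3 := Real.log_pos (by norm_num)
  have hbound : ∀ w : E, 1 ≤ ‖w‖ → δ * Real.log ‖w‖ - (∑ i, a i) * (Real.log 3 - Real.log δ)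
      ≤ ∑ i, a i * Real.log (√(1 + ‖w‖ ^ 2) - ⟪w, z i⟫) := by
    intro w hw
    have hw0 : 0 < ‖w‖ := by linarith
    obtain ⟨j, hj⟩ : ∃ j, ∀ i, (1 - δ) * ‖w‖ < ⟪w, z i⟫ → z i = z j := by
      by_cases h : ∃ j, (1 - δ) * ‖w‖ < ⟪w, z j⟫
      · obtain ⟨j, hj⟩ := h
        refine ⟨j, fun i hi => ?_⟩
        by_contra hne
        have h1 := norm_sub_sq_lt_of_inner_gt (norm_pos_iff.1 hw0) (hz i) (hz j) hi hj
        have h2 := hδ3 i j hne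
        linarith
      · push Not at h
        exact ⟨i₀, fun i hi => absurd hi (h i).not_gt⟩
    -- Only the point in the cap around `w` can contribute about `-log ‖w‖`; all others contribute
    -- at least `log ‖w‖` up to a constant. The weight gap makes the total coefficient exceed `δ`.
    have hterm : ∀ i, (if z i = z j then -1 else 1) * Real.log ‖w‖ - (Real.log 3 - Real.log δ)
        ≤ Real.log (√(1 + ‖w‖ ^ 2) - ⟪w, z i⟫) := by
      intro i
      have hlt := norm_lt_sqrt_one_add_sq w
      have hin := real_inner_le_norm w (z i)
      rw [hz i, mul_one] at hin
      split_ifs with h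
      · have hsq : √(1 + ‖w‖ ^ 2) ≤ 2 * ‖w‖ := Real.sqrt_le_iff.2 ⟨by linarith, by nlinarith⟩
        have h1 : (3 * ‖w‖)⁻¹ ≤ √(1 + ‖w‖ ^ 2) - ⟪w, z i⟫ := by
          refine le_trans ?_ (sub_le_sub_left hin _)
          rw [eq_inv_of_mul_eq_one_left (sqrt_sub_mul_sqrt_add w)]
          exact inv_anti₀ (by positivity) (by linarith)
        have h2 := Real.log_le_log (by positivity) h1
        rw [Real.log_inv, Real.log_mul (by norm_num) hw0.ne'] at h2
        linarith
      · have h1 : δ * ‖w‖ ≤ √(1 + ‖w‖ ^ 2) - ⟪w, z i⟫ := by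
          have := not_lt.1 (mt (hj i) h)
          linarith
        have h2 := Real.log_le_log (by positivity) h1
        rw [Real.log_mul hδ0.ne' hw0.ne'] at h2
        linarith
    have hsum : ∑ i, a i * (if z i = z j then -1 else 1)
        = ∑ i with z i ≠ z j, a i - ∑ i with z i = z j, a i := by
      simp only [mul_ite, mul_one, mul_neg, Finset.sum_ite, Finset.sum_neg_distrib, ne_eq]
      ring
    calc δ * Real.log ‖w‖ - (∑ i, a i) * (Real.log 3 - Real.log δ)
        ≤ (∑ i, a i * (if z i = z j then -1 else 1)) * Real.log ‖w‖
          - (∑ i, a i) * (Real.log 3 - Real.log δ) := by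
          rw [hsum]
          have := mul_le_mul_of_nonneg_right (hδ2 j).le (Real.log_nonneg hw)
          linarith
      _ = ∑ i, a i * ((if z i = z j then -1 else 1) * Real.log ‖w‖
          - (Real.log 3 - Real.log δ)) := by
          simp only [mul_sub, Finset.sum_sub_distrib, Finset.sum_mul, mul_assoc]
      _ ≤ _ := Finset.sum_le_sum fun i _ => mul_le_mul_of_nonneg_left (hterm i) (ha0 i).le
  have hnorm := tendsto_norm_cocompact_atTop (E := E)
  refine Filter.tendsto_atTop_mono' _ (f₁ := fun w : E => δ * Real.log ‖w‖ -
    (∑ i, a i) * (Real.log 3 - Real.log δ)) ?_ ?_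
  · filter_upwards [hnorm.eventually_ge_atTop 1] with w hw using hbound w hw
  · simp only [sub_eq_add_neg]
    exact Filter.tendsto_atTop_add_const_right _ _
      ((Real.tendsto_log_atTop.comp hnorm).const_mul_atTop hδ0)

theorem hasDerivAt_sqrt_one_add_sq (w h : E) : HasDerivAt (fun t : ℝ => √(1 + ‖w + t • h‖ ^ 2))
    (⟪w, h⟫ / √(1 + ‖w‖ ^ 2)) 0 := by
  have h1 : HasDerivAt (fun t : ℝ => w + t • h) h 0 := by
    simpa using ((hasDerivAt_id (0 : ℝ)).smul_const h).const_add w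
  have h2 := ((h1.norm_sq).const_add 1).sqrt (by positivity)
  convert h2 using 1
  simp only [zero_smul, add_zero]
  field_simp

/-- The conformal barycentre: if no point carries half of the weight, the averaged Busemann
function has a critical point. -/
theorem exists_barycentre [FiniteDimensional ℝ E] {a : ι → ℝ} (ha0 : ∀ i, 0 < a i) {z : ι → E}
    (hz : ∀ i, ‖z i‖ = 1)
    (hs : ∀ J : Finset ι, (∀ i ∈ J, ∀ j ∈ J, z i = z j) → ∑ i ∈ J, a i < ∑ i ∈ Jᶜ, a i) :
    ∃ w : E, ∑ i, (a i * (√(1 + ‖w‖ ^ 2) - ⟪w, z i⟫)⁻¹) • z i = (∑ i, a i) • w ∧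
      ∑ i, a i * (√(1 + ‖w‖ ^ 2) - ⟪w, z i⟫)⁻¹ = √(1 + ‖w‖ ^ 2) * ∑ i, a i := by
  have hpos : ∀ (w : E) i, 0 < √(1 + ‖w‖ ^ 2) - ⟪w, z i⟫ := fun w i => sqrt_sub_inner_pos w (hz i)
  have hcont : Continuous fun w : E => ∑ i, a i * Real.log (√(1 + ‖w‖ ^ 2) - ⟪w, z i⟫) :=
    continuous_finsetSum _ fun i _ => continuous_const.mul
      (Continuous.log (by fun_prop) fun w => (hpos w i).ne')
  obtain ⟨w, hw⟩ := hcont.exists_forall_le (tendsto_sum_log ha0 hz hs)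
  set α := √(1 + ‖w‖ ^ 2) with hα
  have hα0 : 0 < α := Real.sqrt_pos.2 (by positivity)
  have hα2 : α ^ 2 = 1 + ‖w‖ ^ 2 := Real.sq_sqrt (by positivity)
  have hposw : ∀ i, 0 < α - ⟪w, z i⟫ := hpos w
  -- The first variation at the minimum vanishes in every direction, which makes `q` a multiple of
  -- `w`; the factor is then found from `α ^ 2 = 1 + ‖w‖ ^ 2`.
  have hcrit : ∀ h : E, ∑ i, a i * ((⟪w, h⟫ / α - ⟪h, z i⟫) / (α - ⟪w, z i⟫)) = 0 := by
    intro h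
    have hd : HasDerivAt (fun t : ℝ => ∑ i, a i * Real.log (√(1 + ‖w + t • h‖ ^ 2)
        - ⟪w + t • h, z i⟫)) (∑ i, a i * ((⟪w, h⟫ / α - ⟪h, z i⟫) / (α - ⟪w, z i⟫))) 0 := by
      refine HasDerivAt.fun_sum fun i _ => HasDerivAt.const_mul _ ?_
      have h1 : HasDerivAt (fun t : ℝ => ⟪w + t • h, z i⟫) ⟪h, z i⟫ 0 := by
        simp only [inner_add_left, real_inner_smul_left]
        simpa using ((hasDerivAt_id (0 : ℝ)).mul_const ⟪h, z i⟫).const_add ⟪w, z i⟫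
      have h2 := ((hasDerivAt_sqrt_one_add_sq w h).sub h1).log (by simpa using (hpos w i).ne')
      simpa using h2
    refine IsLocalMin.hasDerivAt_eq_zero (Filter.Eventually.of_forall fun t => ?_) hd
    simpa using hw (w + t • h)
  set P := ∑ i, a i * (α - ⟪w, z i⟫)⁻¹ with hP
  set q := ∑ i, (a i * (α - ⟪w, z i⟫)⁻¹) • z i with hq
  have hqw : q = (P / α) • w := by
    refine ext_inner_right ℝ fun h => ?_
    rw [hq, sum_inner, real_inner_smul_left, ← sub_eq_zero, ← neg_eq_zero, ← hcrit h, hP,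
      Finset.sum_div, Finset.sum_mul, neg_sub, ← Finset.sum_sub_distrib]
    refine Finset.sum_congr rfl fun i _ => ?_
    rw [real_inner_smul_left, real_inner_comm (z i) h]
    ring
  have hA : ∑ i, a i = α * P - ⟪w, q⟫ := by
    rw [hP, hq, inner_sum, Finset.mul_sum, ← Finset.sum_sub_distrib]
    refine Finset.sum_congr rfl fun i _ => ?_
    rw [inner_smul_right]
    have := (hposw i).ne'
    field_simp
  have hA' : ∑ i, a i = P / α := by
    rw [hA, hqw, inner_smul_right, real_inner_self_eq_norm_sq]
    have : ‖w‖ ^ 2 = α ^ 2 - 1 := by linarith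
    rw [this]
    field_simp
    ring
  refine ⟨w, by rw [hA', ← hqw], ?_⟩
  change P = α * _
  rw [hA']
  field_simp

variable {e : E}

/-- A configuration without points of at least half of the weight can be moved to a closed polygon
by a Möbius map fixing the pole. -/
theorem exists_sum_moebius_eq_zero [FiniteDimensional ℝ E] (he : ‖e‖ = 1) {a : ι → ℝ}
    (ha0 : ∀ i, 0 < a i) {z : ι → E} (hz : ∀ i, ‖z i‖ = 1)
    (hs : ∀ J : Finset ι, (∀ i ∈ J, ∀ j ∈ J, z i = z j) → ∑ i ∈ J, a i < ∑ i ∈ Jᶜ, a i) :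
    ∃ p : E, 0 < ⟪e, p⟫ ∧ ∑ i, a i • moebius e p (z i) = 0 := by
  obtain ⟨w, hw1, hw2⟩ := exists_barycentre ha0 hz hs
  obtain ⟨p, hp, hm⟩ := exists_moebius_eq he w
  refine ⟨p, hp, ?_⟩
  have hr : √(1 + ‖w‖ ^ 2) + ⟪w, e⟫ ≠ 0 := by
    have := sqrt_sub_inner_pos w (z := -e) (by rwa [norm_neg])
    rw [inner_neg_right, sub_neg_eq_add] at this
    exact this.ne'
  have hin : ∑ i, a i * (√(1 + ‖w‖ ^ 2) - ⟪w, z i⟫)⁻¹ * ⟪e, z i⟫ = (∑ i, a i) * ⟪w, e⟫ := by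
    have := congrArg (fun x => ⟪e, x⟫) hw1
    simpa only [inner_sum, inner_smul_right, real_inner_comm w] using this
  have hexp : ∀ i, a i • moebius e p (z i) = -(a i • e)
      + (a i * (√(1 + ‖w‖ ^ 2) - ⟪w, z i⟫)⁻¹) • z i
      - (a i * (√(1 + ‖w‖ ^ 2) - ⟪w, z i⟫)⁻¹ * ⟪e, z i⟫) • e
      + (a i * (√(1 + ‖w‖ ^ 2) - ⟪w, z i⟫)⁻¹
        + a i * (√(1 + ‖w‖ ^ 2) - ⟪w, z i⟫)⁻¹ * ⟪e, z i⟫) •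
        ((√(1 + ‖w‖ ^ 2) + ⟪w, e⟫)⁻¹ • (e - w + ⟪w, e⟫ • e)) := by
    intro i
    rw [hm]
    module
  simp only [hexp]
  rw [Finset.sum_add_distrib, Finset.sum_sub_distrib, Finset.sum_add_distrib,
    Finset.sum_neg_distrib, ← Finset.sum_smul, ← Finset.sum_smul, ← Finset.sum_smul,
    Finset.sum_add_distrib, hw1, hin, hw2, smul_smul,
    show (√(1 + ‖w‖ ^ 2) * ∑ i, a i + (∑ i, a i) * ⟪w, e⟫) * (√(1 + ‖w‖ ^ 2) + ⟪w, e⟫)⁻¹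
      = ∑ i, a i by field_simp]
  module

/-- A Möbius map fixing the pole that moves a generic closed polygon to a closed polygon is the
identity. -/
theorem eq_pole_of_moebius_mem (he : ‖e‖ = 1) {a : ι → ℝ} (ha : Unlined a) (ha0 : ∀ i, 0 < a i)
    {z : ι → E} (hz : z ∈ closedPolygons E a) {p : E} (hp : 0 < ⟪e, p⟫)
    (hpz : (fun i => moebius e p (z i)) ∈ closedPolygons E a) : p = e := by
  by_contra hne
  -- A nontrivial map strictly raises the averaged Busemann function at either polygon. Applied to
  -- the map and to its inverse, the two sums would both be positive, but the cocycle identity makes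
  -- them opposite.
  have key : ∀ q : E, 0 < ⟪e, q⟫ → q ≠ e → ∀ y ∈ closedPolygons E a,
      0 < ∑ i, a i * (Real.log (moebiusDenom e q (y i)) - Real.log ⟪e, q⟫) := by
    intro q hq hqe y hy
    obtain ⟨w, -, hw2, hw3⟩ := exists_moebiusDenom_eq he hq
    refine (ha.sum_log_pos ha0 hy (mt hw3 hqe)).trans_eq (Finset.sum_congr rfl fun i _ => ?_)
    rw [hw2, Real.log_mul hq.ne' (sqrt_sub_inner_pos w (hy.1 i)).ne']
    ring
  have hinv : 0 < ⟪e, moebiusInv e p⟫ := by rw [inner_moebiusInv he]; positivity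
  have h1 := key p hp hne z hz
  have h2 := key (moebiusInv e p) hinv (fun h => hne (by
    have := moebiusComp_inv he hp.ne'
    rw [h] at this
    have hp1 : ⟪e, p⟫ = 1 := by
      have := congrArg (fun x => ⟪e, x⟫) h
      simpa [inner_moebiusInv he, he] using this
    simpa [moebiusComp, he, hp1] using this)) _ hpz
  have h3 := add_pos h1 h2
  rw [← Finset.sum_add_distrib] at h3
  refine h3.ne' (Finset.sum_eq_zero fun i _ => ?_)
  have hD := moebiusDenom_pos he hp (hz.1 i)
  have h4 := moebiusDenom_mul he (moebiusInv e p) hp.ne' hD.ne'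
  rw [moebiusComp_inv he hp.ne', moebiusDenom_self he] at h4
  rw [eq_inv_of_mul_eq_one_left h4, inner_moebiusInv he, Real.log_inv, Real.log_inv]
  ring

end Barycentre

/-! ### Moving closed polygons for one family of weights to another -/

section Transfer

variable {E : Type*} [NormedAddCommGroup E] [InnerProductSpace ℝ E]
  {ι : Type*} [Fintype ι] {e : E}

local notation "⟪" x ", " y "⟫" => inner ℝ x y

/-- The derivative is written as a conformal gradient field, the tangential part of `h - (2 * ⟪e,
h⟫) • e`, plus an infinitesimal rotation, which cancels on closed polygons. -/
theorem hasDerivAt_moebius (he : ‖e‖ = 1) (h z : E) :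
    HasDerivAt (fun t : ℝ => moebius e (e + t • h) z)
      ((h - (2 * ⟪e, h⟫) • e) - ⟪h - (2 * ⟪e, h⟫) • e, z⟫ • z
        + (⟪e, z⟫ • (h - ⟪e, h⟫ • e) - ⟪h - ⟪e, h⟫ • e, z⟫ • e)) 0 := by
  have hid := hasDerivAt_id (0 : ℝ)
  have h1 : ∀ t : ℝ, ⟪e, e + t • h⟫ = 1 + t * ⟪e, h⟫ := fun t => by
    simp [inner_add_right, inner_smul_right, he]
  have hD : HasDerivAt (fun t : ℝ => moebiusDenom e (e + t • h) z)
      (⟪e, h⟫ + ⟪h, z⟫ - 2 * ⟪e, h⟫ * ⟪e, z⟫) 0 := by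
    have h2 : ∀ t : ℝ, ‖e + t • h‖ ^ 2 = 1 + 2 * t * ⟪e, h⟫ + t ^ 2 * ‖h‖ ^ 2 := fun t => by
      rw [norm_add_sq_real, he, norm_smul, mul_pow, Real.norm_eq_abs, sq_abs, inner_smul_right]
      ring
    simp only [moebiusDenom, h1, h2, inner_add_left, real_inner_smul_left]
    have h3 : HasDerivAt (fun t : ℝ => 1 + t * ⟪e, h⟫) ⟪e, h⟫ 0 := by
      simpa using (hid.mul_const ⟪e, h⟫).const_add 1
    have h4 : HasDerivAt (fun t : ℝ => ⟪e, z⟫ + t * ⟪h, z⟫) ⟪h, z⟫ 0 := by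
      simpa using (hid.mul_const ⟪h, z⟫).const_add ⟪e, z⟫
    have h5 : HasDerivAt (fun t : ℝ => 1 + 2 * t * ⟪e, h⟫ + t ^ 2 * ‖h‖ ^ 2) (2 * ⟪e, h⟫) 0 := by
      refine ((((hid.const_mul 2).mul_const ⟪e, h⟫).const_add 1).add
        ((hid.pow 2).mul_const (‖h‖ ^ 2))).congr_deriv ?_
      simp
    have h6 := ((((h3.pow 2).mul (((((h4.sub (h3.mul_const ⟪e, z⟫)).const_mul 2).const_add
      (1 - ⟪e, z⟫)).add ((h5.sub (h3.pow 2)).mul_const (1 + ⟪e, z⟫))))).const_add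
      (1 + ⟪e, z⟫)).div_const 2)
    refine h6.congr_deriv ?_
    simp
    ring
  have hV : HasDerivAt (fun t : ℝ => (1 + ⟪e, z⟫) • e + (1 + t * ⟪e, h⟫) •
      (z - ⟪e, z⟫ • e + (1 + ⟪e, z⟫) • (t • (h - ⟪e, h⟫ • e))))
      (⟪e, h⟫ • (z - ⟪e, z⟫ • e) + (1 + ⟪e, z⟫) • (h - ⟪e, h⟫ • e)) 0 := by
    have h3 : HasDerivAt (fun t : ℝ => 1 + t * ⟪e, h⟫) ⟪e, h⟫ 0 := by
      simpa using (hid.mul_const ⟪e, h⟫).const_add 1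
    have h4 := ((hid.smul_const (h - ⟪e, h⟫ • e)).const_smul (1 + ⟪e, z⟫)).const_add
      (z - ⟪e, z⟫ • e)
    refine ((h3.smul h4).const_add ((1 + ⟪e, z⟫) • e)).congr_deriv ?_
    simp
    module
  have hD0 : moebiusDenom e (e + (0 : ℝ) • h) z = 1 := by
    rw [zero_smul, add_zero, moebiusDenom_self he]
  have hm := ((hD.fun_inv (by rw [hD0]; exact one_ne_zero)).smul hV).const_add (-e)
  refine (hm.congr_of_eventuallyEq (Filter.Eventually.of_forall fun t => ?_)).congr_deriv ?_
  · simp only [moebius, h1, Pi.smul_apply']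
    module
  · simp only [hD0, inner_sub_left, real_inner_smul_left]
    module

theorem contDiffAt_moebiusDenom {V : Type*} [NormedAddCommGroup V] [NormedSpace ℝ V]
    {p z : V → E} {x : V} (hp : ContDiffAt ℝ ω p x) (hz : ContDiffAt ℝ ω z x) :
    ContDiffAt ℝ ω (fun y => moebiusDenom e (p y) (z y)) x := by
  have h1 : ContDiffAt ℝ ω (fun y => ⟪e, p y⟫) x := contDiffAt_const.inner ℝ hp
  have h2 : ContDiffAt ℝ ω (fun y => ⟪e, z y⟫) x := contDiffAt_const.inner ℝ hz
  have h3 : ContDiffAt ℝ ω (fun y => ⟪p y, z y⟫) x := hp.inner ℝ hz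
  have h4 : ContDiffAt ℝ ω (fun y => ‖p y‖ ^ 2) x := hp.norm_sq ℝ
  unfold moebiusDenom
  fun_prop

theorem contDiffAt_moebius {V : Type*} [NormedAddCommGroup V] [NormedSpace ℝ V]
    {p z : V → E} {x : V} (hp : ContDiffAt ℝ ω p x) (hz : ContDiffAt ℝ ω z x)
    (hD : moebiusDenom e (p x) (z x) ≠ 0) :
    ContDiffAt ℝ ω (fun y => moebius e (p y) (z y)) x := by
  have h1 : ContDiffAt ℝ ω (fun y => ⟪e, p y⟫) x := contDiffAt_const.inner ℝ hp
  have h2 : ContDiffAt ℝ ω (fun y => ⟪e, z y⟫) x := contDiffAt_const.inner ℝ hz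
  have h3 := (contDiffAt_moebiusDenom hp hz).inv hD
  have h4 : ContDiffAt ℝ ω (fun y => (1 + ⟪e, z y⟫) • e
      + ⟪e, p y⟫ • (z y - ⟪e, z y⟫ • e + (1 + ⟪e, z y⟫) • (p y - ⟪e, p y⟫ • e))) x := by
    fun_prop
  exact contDiffAt_const.add (h3.smul h4)

/-- Near a generic closed polygon, the Möbius map that closes up a configuration depends
analytically on the configuration. -/
theorem exists_contDiffAt_closing [FiniteDimensional ℝ E] [DecidableEq ι] (he : ‖e‖ = 1)
    {a : ι → ℝ} (ha : Unlined a) (ha0 : ∀ i, 0 < a i) {y₀ : ι → E}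
    (hy : y₀ ∈ closedPolygons E a) :
    ∃ φ : (ι → E) → E, ContDiffAt ℝ ω φ y₀ ∧ φ y₀ = e ∧
      ∀ᶠ y in nhds y₀, ∑ i, a i • moebius e (φ y) (y i) = 0 := by
  have : CompleteSpace E := FiniteDimensional.complete ℝ E
  set f : (ι → E) × E → E := fun u => ∑ i, a i • moebius e u.2 (u.1 i) with hf
  have hcd : ContDiffAt ℝ ω f (y₀, e) := by
    refine ContDiffAt.sum fun i _ => contDiffAt_const.smul ?_
    refine contDiffAt_moebius contDiffAt_snd ?_ (by simp [moebiusDenom_self he])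
    fun_prop
  have hinj : Function.Injective (fderiv ℝ f (y₀, e) ∘L .inr ℝ (ι → E) E) := by
    rw [injective_iff_map_eq_zero]
    intro h hh
    have hpath : HasDerivAt (fun t : ℝ => (y₀, e + t • h)) ((0 : ι → E), h) 0 := by
      refine (hasDerivAt_const (0 : ℝ) y₀).prodMk ?_
      simpa using ((hasDerivAt_id (0 : ℝ)).smul_const h).const_add e
    have hfd : HasFDerivAt f (fderiv ℝ f (y₀, e)) ((fun t : ℝ => (y₀, e + t • h)) 0) := by
      simpa using (hcd.differentiableAt (by simp)).hasFDerivAt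
    have h1 := hfd.comp_hasDerivAt (0 : ℝ) hpath
    have h2 : HasDerivAt (fun t : ℝ => ∑ i, a i • moebius e (e + t • h) (y₀ i)) _ 0 :=
      HasDerivAt.fun_sum fun i _ => (hasDerivAt_moebius he h (y₀ i)).const_smul (a i)
    have h3 := h1.unique h2
    have h4 : fderiv ℝ f (y₀, e) (0, h) = 0 := hh
    rw [h4] at h3
    set u := h - (2 * ⟪e, h⟫) • e with hu
    set b := h - ⟪e, h⟫ • e with hb
    have hzero : ∀ v : E, ∑ i, a i * ⟪v, y₀ i⟫ = 0 := fun v => by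
      have := congrArg (fun x => ⟪v, x⟫) hy.2
      simpa [inner_sum, inner_smul_right] using this
    -- Pairing with `u` removes the rotation part, since the polygon is closed. The remaining terms
    -- are nonnegative, and one is positive unless `u = 0`.
    have h5 : ∑ i, a i * (‖u‖ ^ 2 - ⟪u, y₀ i⟫ ^ 2) = 0 := by
      have h6 := congrArg (fun x => ⟪u, x⟫) h3
      simp only [inner_zero_right, inner_sum, inner_smul_right, inner_add_right, inner_sub_right,
        real_inner_self_eq_norm_sq] at h6
      have h7 : ∑ i, a i * (‖u‖ ^ 2 - ⟪u, y₀ i⟫ ^ 2) + ⟪u, b⟫ * ∑ i, a i * ⟪e, y₀ i⟫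
          - ⟪u, e⟫ * ∑ i, a i * ⟪b, y₀ i⟫ = 0 := by
        rw [h6, Finset.mul_sum, Finset.mul_sum, ← Finset.sum_add_distrib,
          ← Finset.sum_sub_distrib]
        exact Finset.sum_congr rfl fun i _ => by ring
      rwa [hzero, hzero, mul_zero, mul_zero, add_zero, sub_zero] at h7
    have hu0 : u = 0 := by
      by_contra hne
      obtain ⟨j, hj⟩ := ha.exists_abs_inner_lt hy hne
      refine (Finset.sum_pos' (fun i _ => mul_nonneg (ha0 i).le ?_)
        ⟨j, Finset.mem_univ j, mul_pos (ha0 j) ?_⟩).ne' h5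
      · have := abs_real_inner_le_norm u (y₀ i)
        rw [hy.1 i, mul_one] at this
        rw [sub_nonneg]
        exact sq_le_sq.2 (by rwa [abs_norm])
      · rw [sub_pos]
        exact sq_lt_sq.2 (by rwa [abs_norm])
    have h8 : ⟪e, h⟫ = 0 := by
      have := congrArg (fun x => ⟪e, x⟫) hu0
      simp only [hu, inner_sub_right, inner_smul_right, real_inner_self_eq_norm_sq, he,
        inner_zero_right] at this
      linarith
    rw [hu, h8] at hu0
    simpa using hu0
  have hinv : (fderiv ℝ f (y₀, e) ∘L .inr ℝ (ι → E) E).IsInvertible :=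
    ⟨(LinearEquiv.ofInjectiveEndo _ hinj).toContinuousLinearEquiv, by ext; rfl⟩
  have h0 : (ω : WithTop ℕ∞) ≠ 0 := by simp
  refine ⟨hcd.implicitFunction h0 hinv, hcd.contDiffAt_implicitFunction h0 hinv,
    hcd.implicitFunction_apply_self h0 hinv, ?_⟩
  filter_upwards [hcd.eventually_apply_implicitFunction h0 hinv] with y hy'
  refine hy'.trans ?_
  simpa [hf, moebius_self he] using hy.2

/-! ### Uniqueness of the closing Möbius map and its consequences -/

theorem moebius_inv_moebius (he : ‖e‖ = 1) {p z : E} (hp : 0 < ⟪e, p⟫) (hz : ‖z‖ = 1) :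
    moebius e (moebiusInv e p) (moebius e p z) = z := by
  rw [moebius_moebius he _ hp.ne' (moebiusDenom_pos he hp hz).ne', moebiusComp_inv he hp.ne',
    moebius_self he]

theorem moebius_mem_closedPolygons (he : ‖e‖ = 1) {a : ι → ℝ} {p : E} (hp : 0 < ⟪e, p⟫)
    {z : ι → E} (hz : ∀ i, ‖z i‖ = 1) (h : ∑ i, a i • moebius e p (z i) = 0) :
    (fun i => moebius e p (z i)) ∈ closedPolygons E a :=
  ⟨fun i => norm_moebius he (hz i) (moebiusDenom_pos he hp (hz i)).ne', h⟩

/-- The map of `q` after the inverse of that of `p` carries one closed polygon to another, hence is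
the identity. -/
theorem moebius_param_unique [DecidableEq ι] (he : ‖e‖ = 1) {a : ι → ℝ} (ha : Unlined a)
    (ha0 : ∀ i, 0 < a i) {z : ι → E} (hz : ∀ i, ‖z i‖ = 1) {p q : E}
    (hp : 0 < ⟪e, p⟫) (hpz : ∑ i, a i • moebius e p (z i) = 0)
    (hq : 0 < ⟪e, q⟫) (hqz : ∑ i, a i • moebius e q (z i) = 0) : q = p := by
  have hpz' := moebius_mem_closedPolygons he hp hz hpz
  have hqz' := moebius_mem_closedPolygons he hq hz hqz
  have hinv : 0 < ⟪e, moebiusInv e p⟫ := by rw [inner_moebiusInv he]; positivity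
  refine eq_of_moebiusComp_inv_eq he hp.ne' (eq_pole_of_moebius_mem he ha ha0 hpz' ?_ ?_)
  · rw [inner_moebiusComp he]
    positivity
  · convert hqz' using 2 with i
    rw [← moebius_moebius he q hinv.ne' (moebiusDenom_pos he hinv (hpz'.1 i)).ne',
      moebius_inv_moebius he hp (hz i)]

open scoped Classical in
/-- The parameter of the Möbius map that makes `z` a closed polygon for the weights `a`. -/
def closingParam (e : E) (a : ι → ℝ) (z : ι → E) : E :=
  if h : ∃ p : E, 0 < ⟪e, p⟫ ∧ ∑ i, a i • moebius e p (z i) = 0 then h.choose else e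

/-- The closed polygon for the weights `a` in the Möbius orbit of `z`. -/
def closing (e : E) (a : ι → ℝ) (z : ι → E) (i : ι) : E := moebius e (closingParam e a z) (z i)

/-- Every closed polygon for the weights `a` has Möbius images that are closed for `b`. -/
def Closable (e : E) (a b : ι → ℝ) : Prop :=
  ∀ z ∈ closedPolygons E a, ∃ p : E, 0 < ⟪e, p⟫ ∧ ∑ i, b i • moebius e p (z i) = 0

theorem closingParam_spec {b : ι → ℝ} {z : ι → E}
    (h : ∃ p : E, 0 < ⟪e, p⟫ ∧ ∑ i, b i • moebius e p (z i) = 0) :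
    0 < ⟪e, closingParam e b z⟫ ∧ ∑ i, b i • moebius e (closingParam e b z) (z i) = 0 := by
  rw [closingParam, dif_pos h]
  exact h.choose_spec

theorem closing_mem (he : ‖e‖ = 1) {a b : ι → ℝ} (hab : Closable e a b) {z : ι → E}
    (hz : z ∈ closedPolygons E a) : closing e b z ∈ closedPolygons E b :=
  have h := closingParam_spec (hab z hz)
  moebius_mem_closedPolygons he h.1 hz.1 h.2

/-- This is why only Möbius maps fixing the pole are used: the last edge stays in place, so the
result is again a chain. -/
theorem closing_pole (he : ‖e‖ = 1) (b : ι → ℝ) {z : ι → E} {i : ι} (hi : z i = -e) :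
    closing e b z i = -e := by
  rw [closing, hi, moebius_neg_pole he]

variable [DecidableEq ι]

theorem closingParam_eq (he : ‖e‖ = 1) {b : ι → ℝ} (hb : Unlined b) (hb0 : ∀ i, 0 < b i)
    {z : ι → E} (hz : ∀ i, ‖z i‖ = 1) {p : E} (hp : 0 < ⟪e, p⟫)
    (hpz : ∑ i, b i • moebius e p (z i) = 0) : closingParam e b z = p :=
  have h := closingParam_spec ⟨p, hp, hpz⟩
  moebius_param_unique he hb hb0 hz hp hpz h.1 h.2

/-- The inverse Möbius map closes the image for `a`, so by uniqueness it is the one chosen. -/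
theorem closing_closing (he : ‖e‖ = 1) {a b : ι → ℝ} (ha : Unlined a) (ha0 : ∀ i, 0 < a i)
    (hab : Closable e a b) {z : ι → E} (hz : z ∈ closedPolygons E a) :
    closing e a (closing e b z) = z := by
  have h := closingParam_spec (hab z hz)
  have hinv : ∀ i, moebius e (moebiusInv e (closingParam e b z)) (closing e b z i) = z i :=
    fun i => moebius_inv_moebius he h.1 (hz.1 i)
  have hp : closingParam e a (closing e b z) = moebiusInv e (closingParam e b z) := by
    refine closingParam_eq he ha ha0 (closing_mem he hab hz).1 ?_ ?_
    · rw [inner_moebiusInv he]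
      exact inv_pos.2 h.1
    · simp only [hinv]
      exact hz.2
  funext i
  rw [closing, hp, hinv]

/-- Conjugation by `A` turns the parameter `p` into `A p`; uniqueness does the rest. -/
theorem closing_map (he : ‖e‖ = 1) {a b : ι → ℝ} (hb : Unlined b) (hb0 : ∀ i, 0 < b i)
    (hab : Closable e a b) {z : ι → E} (hz : z ∈ closedPolygons E a) (A : E ≃ₗᵢ[ℝ] E)
    (hA : A e = e) (i : ι) : closing e b (fun i => A (z i)) i = A (closing e b z i) := by
  have h := closingParam_spec (hab z hz)
  have hp : closingParam e b (fun i => A (z i)) = A (closingParam e b z) := by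
    refine closingParam_eq he hb hb0 (fun i => by rw [A.norm_map, hz.1]) ?_ ?_
    · have h1 := A.inner_map_map e (closingParam e b z)
      rw [hA] at h1
      rw [h1]
      exact h.1
    · simp only [moebius_map A hA, ← map_smul, ← map_sum, h.2, map_zero]
  rw [closing, hp, moebius_map A hA, closing]

/-- The passage from closed polygons for one family of weights to those for another is smooth. -/
theorem exists_contDiffAt_eq_closing [FiniteDimensional ℝ E] (he : ‖e‖ = 1) {a b : ι → ℝ}
    (hb : Unlined b) (hb0 : ∀ i, 0 < b i) (hab : Closable e a b) {z₀ : ι → E}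
    (hz₀ : z₀ ∈ closedPolygons E a) :
    ∃ F : (ι → E) → ι → E, ContDiffAt ℝ ω F z₀ ∧
      ∀ᶠ z in nhds z₀, z ∈ closedPolygons E a → F z = closing e b z := by
  have h₀ := closingParam_spec (hab z₀ hz₀)
  set p₀ := closingParam e b z₀
  obtain ⟨φ, hφ1, hφ2, hφ3⟩ := exists_contDiffAt_closing he hb hb0 (closing_mem he hab hz₀)
  -- The fixed map `p₀` nearly closes the configurations near `z₀`; `φ` supplies the remaining small
  -- correction, and uniqueness identifies the composite with `closing`.
  set g : (ι → E) → ι → E := fun z i => moebius e p₀ (z i) with hg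
  have hgc : ContDiffAt ℝ ω g z₀ := contDiffAt_pi.2 fun i =>
    contDiffAt_moebius contDiffAt_const (by fun_prop) (moebiusDenom_pos he h₀.1 (hz₀.1 i)).ne'
  have hg₀ : g z₀ = closing e b z₀ := rfl
  rw [← hg₀] at hφ1 hφ2 hφ3
  refine ⟨fun z i => moebius e (φ (g z)) (g z i), contDiffAt_pi.2 fun i => ?_, ?_⟩
  · refine contDiffAt_moebius (hφ1.comp z₀ hgc) (contDiffAt_pi.1 hgc i) ?_
    rw [hφ2, moebiusDenom_self he]
    exact one_ne_zero
  · have hφpos : ∀ᶠ y in nhds (g z₀), 0 < ⟪e, φ y⟫ := by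
      have hc : ContinuousAt (fun y => ⟪e, φ y⟫) (g z₀) :=
        continuousAt_const.inner hφ1.continuousAt
      refine hc.eventually (lt_mem_nhds ?_)
      simp only [hφ2]
      rw [real_inner_self_eq_norm_sq, he]
      norm_num
    filter_upwards [hgc.continuousAt.eventually hφ3, hgc.continuousAt.eventually hφpos]
      with z h1 h2 hz
    have h3 : ∀ i, moebius e (φ (g z)) (g z i) = moebius e (moebiusComp e (φ (g z)) p₀) (z i) :=
      fun i => moebius_moebius he _ h₀.1.ne' (moebiusDenom_pos he h₀.1 (hz.1 i)).ne'
    have h4 : closingParam e b z = moebiusComp e (φ (g z)) p₀ := by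
      refine closingParam_eq he hb hb0 hz.1 ?_ ?_
      · rw [inner_moebiusComp he]
        exact mul_pos h2 h₀.1
      · simpa only [h3] using h1
    funext i
    rw [h3, closing, h4]

/-- A closed polygon for generic weights has no point with half of the weight. -/
theorem Unlined.sum_lt_of_forall_eq {a : ι → ℝ} (ha : Unlined a) (ha0 : ∀ i, 0 < a i) {z : ι → E}
    (hz : z ∈ closedPolygons E a) {J : Finset ι} (hJ : ∀ i ∈ J, ∀ j ∈ J, z i = z j) :
    ∑ i ∈ J, a i < ∑ i ∈ Jᶜ, a i := by
  refine lt_of_le_of_ne ?_ (ha J)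
  rcases J.eq_empty_or_nonempty with rfl | ⟨j, hj⟩
  · rw [Finset.sum_empty]
    exact Finset.sum_nonneg fun i _ => (ha0 i).le
  have h1 : ∑ i ∈ J, a i • z i = (∑ i ∈ J, a i) • z j := by
    rw [Finset.sum_smul]
    exact Finset.sum_congr rfl fun i hi => by rw [hJ i hi j hj]
  have h2 : (∑ i ∈ J, a i) • z j = -∑ i ∈ Jᶜ, a i • z i := by
    rw [← h1, eq_neg_iff_add_eq_zero, Finset.sum_add_sum_compl, hz.2]
  have h3 := congrArg norm h2
  rw [norm_smul, hz.1, mul_one, norm_neg, Real.norm_of_nonneg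
    (Finset.sum_nonneg fun i _ => (ha0 i).le)] at h3
  rw [h3]
  refine (norm_sum_le _ _).trans_eq (Finset.sum_congr rfl fun i _ => ?_)
  rw [norm_smul, hz.1, mul_one, Real.norm_of_nonneg (ha0 i).le]

theorem Unlined.not_sum_lt_iff {a : ι → ℝ} (ha : Unlined a) (J : Finset ι) :
    ¬ ∑ i ∈ J, a i < ∑ i ∈ Jᶜ, a i ↔ ∑ i ∈ Jᶜ, a i < ∑ i ∈ Jᶜᶜ, a i := by
  rw [compl_compl, not_lt]
  exact ⟨fun h => lt_of_le_of_ne h (ha J).symm, le_of_lt⟩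

/-- Coinciding edges form a set short for `a`. It is short for `b` by `h`, applied to the set or to
its complement according to which contains `m`; so the barycentre for `b` exists. -/
theorem closable_of_short_iff [FiniteDimensional ℝ E] (he : ‖e‖ = 1) {a b : ι → ℝ}
    (ha : Unlined a) (ha0 : ∀ i, 0 < a i) (hb : Unlined b) (hb0 : ∀ i, 0 < b i) (m : ι)
    (h : ∀ J : Finset ι, m ∈ J →
      (∑ i ∈ J, a i < ∑ i ∈ Jᶜ, a i ↔ ∑ i ∈ J, b i < ∑ i ∈ Jᶜ, b i)) :
    Closable e a b := by
  intro z hz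
  refine exists_sum_moebius_eq_zero he hb0 hz.1 fun J hJ => ?_
  have hs := ha.sum_lt_of_forall_eq ha0 hz hJ
  by_cases hm : m ∈ J
  · exact (h J hm).1 hs
  · by_contra hn
    exact (ha.not_sum_lt_iff J).2
      ((h Jᶜ (Finset.mem_compl.2 hm)).2 ((hb.not_sum_lt_iff J).1 hn)) hs

end Transfer

/-! ### Isomorphisms of posets of subsets with a common point -/

section Poset

variable {α : Type*} [DecidableEq α] {m : α} {S T : Set (Finset α)}

/-- Deleting points other than `m` one by one gives a chain below `J`, whose image is a chain of
strict inclusions. -/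
theorem card_le_card_orderIso (hS : ∀ J ∈ S, m ∈ J) (hS' : ∀ J ∈ S, ∀ K ⊆ J, m ∈ K → K ∈ S)
    (hT : ∀ J ∈ T, m ∈ J) (f : S ≃o T) (J : S) : J.1.card ≤ (f J).1.card := by
  induction h : J.1.card generalizing J with
  | zero => exact Nat.zero_le _
  | succ k ih =>
    by_cases hJ : ∃ i ∈ J.1, i ≠ m
    · obtain ⟨i, hi, him⟩ := hJ
      have hK : J.1.erase i ∈ S := hS' _ J.2 _ (Finset.erase_subset _ _)
        (Finset.mem_erase.2 ⟨him.symm, hS _ J.2⟩)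
      have h1 : (⟨J.1.erase i, hK⟩ : S) < J := Finset.erase_ssubset hi
      have h2 : (f ⟨J.1.erase i, hK⟩).1 ⊂ (f J).1 := f.strictMono h1
      have h3 := ih ⟨J.1.erase i, hK⟩ (by rw [Finset.card_erase_of_mem hi, h]; rfl)
      exact h3.trans_lt (Finset.card_lt_card h2)
    · push Not at hJ
      have h1 : J.1.card ≤ 1 := Finset.card_le_one.2 fun i hi j hj => (hJ i hi).trans (hJ j hj).symm
      have h2 := Finset.card_pos.2 ⟨m, hT _ (f J).2⟩
      omega

theorem card_orderIso (hS : ∀ J ∈ S, m ∈ J) (hS' : ∀ J ∈ S, ∀ K ⊆ J, m ∈ K → K ∈ S)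
    (hT : ∀ J ∈ T, m ∈ J) (hT' : ∀ J ∈ T, ∀ K ⊆ J, m ∈ K → K ∈ T) (f : S ≃o T) (J : S) :
    (f J).1.card = J.1.card := by
  refine le_antisymm ?_ (card_le_card_orderIso hS hS' hT f J)
  simpa using card_le_card_orderIso hT hT' hS f.symm (f J)

theorem pair_right_injective {i j m : α} (h : ({i, m} : Finset α) = {j, m}) : i = j := by
  have h1 : i ∈ ({j, m} : Finset α) := h ▸ Finset.mem_insert_self _ _
  have h2 : j ∈ ({i, m} : Finset α) := h ▸ Finset.mem_insert_self _ _
  simp only [Finset.mem_insert, Finset.mem_singleton] at h1 h2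
  rcases h1 with h1 | h1
  · exact h1
  · rcases h2 with h2 | h2
    · exact h2.symm
    · rw [h1, h2]

/-- The value `j = m` covers the singleton, so `m` is treated like a vertex below. -/
theorem exists_eq_pair {K : Finset α} (hm : m ∈ K) (hK : K.card ≤ 2) : ∃ j, K = {j, m} := by
  have h := Finset.card_erase_of_mem hm
  rcases (K.erase m).eq_empty_or_nonempty with h0 | ⟨j, hj⟩
  · refine ⟨m, ?_⟩
    rw [← Finset.insert_erase hm, h0]
    simp
  · refine ⟨j, ?_⟩
    have h1 : K.erase m = {j} := (Finset.eq_of_subset_of_card_le (Finset.singleton_subset_iff.2 hj)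
      (by rw [Finset.card_singleton]; omega)).symm
    rw [← Finset.insert_erase hm, h1, Finset.pair_comm]

theorem exists_orderIso_pair (hS : ∀ J ∈ S, m ∈ J) (hS' : ∀ J ∈ S, ∀ K ⊆ J, m ∈ K → K ∈ S)
    (hT : ∀ J ∈ T, m ∈ J) (hT' : ∀ J ∈ T, ∀ K ⊆ J, m ∈ K → K ∈ T) (f : S ≃o T)
    (i : {i // {i, m} ∈ S}) : ∃ j : {j // {j, m} ∈ T}, f ⟨{i.1, m}, i.2⟩ = ⟨{j.1, m}, j.2⟩ := by
  obtain ⟨j, hj⟩ := exists_eq_pair (hT _ (f ⟨{i.1, m}, i.2⟩).2)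
    ((card_orderIso hS hS' hT hT' f _).trans_le Finset.card_le_two)
  exact ⟨⟨j, hj ▸ (f ⟨{i.1, m}, i.2⟩).2⟩, Subtype.ext hj⟩

/-- An isomorphism between simplicial complexes, seen as posets of sets with a common extra
point, comes from a bijection of the vertices. -/
theorem exists_perm_of_orderIso [Fintype α] (hS : ∀ J ∈ S, m ∈ J)
    (hS' : ∀ J ∈ S, ∀ K ⊆ J, m ∈ K → K ∈ S) (hT : ∀ J ∈ T, m ∈ J)
    (hT' : ∀ J ∈ T, ∀ K ⊆ J, m ∈ K → K ∈ T) (f : S ≃o T) :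
    ∃ τ : Equiv.Perm α, τ m = m ∧ ∀ J, m ∈ J → (J ∈ S ↔ J.map τ.toEmbedding ∈ T) := by
  classical
  rcases S.eq_empty_or_nonempty with h0 | ⟨J₀, hJ₀⟩
  · refine ⟨1, rfl, fun J _ => ⟨fun h => ?_, fun h => ?_⟩⟩
    · simp [h0] at h
    · have := (f.symm ⟨_, h⟩).2
      simp [h0] at this
  choose σ hσ using exists_orderIso_pair hS hS' hT hT' f
  have hbij : Function.Bijective σ := by
    refine ⟨fun i j hij => ?_, fun j => ?_⟩
    · have h := f.injective ((hσ i).trans ((congrArg (fun x : {j // {j, m} ∈ T} =>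
        (⟨{x.1, m}, x.2⟩ : T)) hij).trans (hσ j).symm))
      exact Subtype.ext (pair_right_injective (congrArg Subtype.val h))
    · obtain ⟨i, hi⟩ := exists_orderIso_pair hT hT' hS hS' f.symm j
      rw [OrderIso.symm_apply_eq, hσ] at hi
      exact ⟨i, Subtype.ext (pair_right_injective (congrArg Subtype.val hi)).symm⟩
  -- Indices in no member of `S` are matched arbitrarily with those in no member of `T`.
  set τ : Equiv.Perm α := (Equiv.ofBijective σ hbij).extendSubtype
  have hτ : ∀ (i : α) (hi : {i, m} ∈ S), τ i = σ ⟨i, hi⟩ := fun i hi =>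
    Equiv.extendSubtype_apply_of_mem _ i hi
  have hmap : ∀ J (hJ : J ∈ S), J.map τ.toEmbedding = (f ⟨J, hJ⟩).1 := by
    intro J hJ
    ext j
    rw [Finset.mem_map]
    constructor
    · rintro ⟨i, hi, rfl⟩
      have hsub : {i, m} ⊆ J := Finset.insert_subset hi (Finset.singleton_subset_iff.2 (hS _ hJ))
      have hmem : {i, m} ∈ S := hS' J hJ _ hsub (by simp)
      have h1 : (f ⟨{i, m}, hmem⟩).1 ⊆ (f ⟨J, hJ⟩).1 :=
        f.monotone (show (⟨{i, m}, hmem⟩ : S) ≤ ⟨J, hJ⟩ from hsub)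
      rw [hσ ⟨i, hmem⟩] at h1
      rw [Equiv.coe_toEmbedding, hτ i hmem]
      exact h1 (Finset.mem_insert_self _ _)
    · intro hj
      have hsub : {j, m} ⊆ (f ⟨J, hJ⟩).1 :=
        Finset.insert_subset hj (Finset.singleton_subset_iff.2 (hT _ (f ⟨J, hJ⟩).2))
      have hmem : {j, m} ∈ T := hT' _ (f ⟨J, hJ⟩).2 _ hsub (by simp)
      obtain ⟨i, hi⟩ := hbij.2 ⟨j, hmem⟩
      have h1 : f ⟨{i.1, m}, i.2⟩ ≤ f ⟨J, hJ⟩ := by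
        rw [hσ, hi]
        exact hsub
      have h2 : ({i.1, m} : Finset α) ⊆ J := f.le_iff_le.1 h1
      refine ⟨i.1, h2 (Finset.mem_insert_self _ _), ?_⟩
      rw [Equiv.coe_toEmbedding, hτ i.1 i.2, hi]
  refine ⟨τ, ?_, fun J hJ => ⟨fun h => hmap J h ▸ (f ⟨J, h⟩).2, fun h => ?_⟩⟩
  -- `f` preserves cardinality, so the image of the least element `{m}` is a singleton, which forces
  -- `τ m = m`.
  · have hmem : {m, m} ∈ S := hS' J₀ hJ₀ _ (by simpa using hS _ hJ₀) (by simp)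
    have h1 := card_orderIso hS hS' hT hT' f ⟨{m, m}, hmem⟩
    rw [hσ ⟨m, hmem⟩] at h1
    change ({(σ ⟨m, hmem⟩).1, m} : Finset α).card = ({m, m} : Finset α).card at h1
    rw [Finset.pair_eq_singleton m, Finset.card_singleton] at h1
    rw [hτ m hmem]
    by_contra hne
    rw [Finset.card_pair hne] at h1
    omega
  · have h1 := hmap _ (f.symm ⟨_, h⟩).2
    rw [Subtype.coe_eta, OrderIso.apply_symm_apply] at h1
    exact (Finset.map_injective _ h1) ▸ (f.symm ⟨_, h⟩).2

end Poset

/-! ### Smooth maps and quotients -/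

section SmoothMaps

variable {V W Z : Type*} [NormedAddCommGroup V] [NormedSpace ℝ V]
  [NormedAddCommGroup W] [NormedSpace ℝ W] [NormedAddCommGroup Z] [NormedSpace ℝ Z]

theorem SmoothAt.of_contDiffAt {X : Set V} {f : X → W} {x : X} {F : V → W}
    (hF : ContDiffAt ℝ ω F x) (h : ∀ᶠ y in nhds (x : V), ∀ hy : y ∈ X, F y = f ⟨y, hy⟩) :
    SmoothAt f x := by
  -- Analyticity gives one neighbourhood for all orders of differentiability; `C^∞` at a point alone
  -- would not.
  obtain ⟨u, hu, hFu⟩ := hF.contDiffOn (m := ∞) le_top (fun _ => rfl)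
  obtain ⟨U, hU, hUo, hxU⟩ := mem_nhds_iff.1 (Filter.inter_mem hu h)
  exact ⟨U, hUo, hxU, F, hFu.mono fun y hy => (hU hy).1, fun y hy => (hU hy).2 y.2⟩

theorem SmoothAt.comp {X : Set V} {Y : Set W} {g : Y → Z} {f : X → Y} {x : X}
    (hg : SmoothAt g (f x)) (hf : SmoothAt (fun y => (f y : W)) x) :
    SmoothAt (fun y => g (f y)) x := by
  obtain ⟨U, hU, hxU, F, hF, hFf⟩ := hf
  obtain ⟨U', hU', hxU', G, hG, hGg⟩ := hg
  refine ⟨U ∩ F ⁻¹' U', hF.continuousOn.isOpen_inter_preimage hU hU', ⟨hxU, ?_⟩, G ∘ F,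
    hG.comp (hF.mono Set.inter_subset_left) fun y hy => hy.2, fun y hy => ?_⟩
  · rw [Set.mem_preimage, hFf x hxU]
    exact hxU'
  · have h1 := hFf y hy.1
    have h2 := hy.2
    rw [Set.mem_preimage, h1] at h2
    rw [Function.comp_apply, h1, hGg _ h2]

theorem Smooth.continuous {X : Set V} {Y : Set W} {f : X → Y} (hf : Smooth f) : Continuous f := by
  refine continuous_iff_continuousAt.2 fun x => ?_
  obtain ⟨U, hU, hxU, F, hF, hFf⟩ := hf x
  rw [ContinuousAt, tendsto_subtype_rng]
  have h1 : Filter.Tendsto (fun y : X => F y) (nhds x) (nhds (F x)) :=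
    ((hF.continuousOn.continuousAt (hU.mem_nhds hxU)).tendsto).comp continuousAt_subtype_val
  rw [hFf x hxU] at h1
  refine h1.congr' ?_
  filter_upwards [continuousAt_subtype_val.eventually (hU.mem_nhds hxU)] with y hy using hFf y hy

end SmoothMaps

theorem ChainsEquivariantlyDiffeomorphic.polygonsDiffeomorphic {d : ℕ} [NeZero d] {n : ℕ}
    {a a' : Fin (n + 1) → ℝ} (h : ChainsEquivariantlyDiffeomorphic d a a') :
    PolygonsDiffeomorphic d a a' := by
  obtain ⟨Ψ, h1, h2, h3⟩ := h
  have hrel : ∀ x y, MulAction.orbitRel (specialOrthogonalSub d) (chainSpace d a) x y ↔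
      MulAction.orbitRel (specialOrthogonalSub d) (chainSpace d a') (Ψ x) (Ψ y) := by
    intro x y
    constructor
    · rintro ⟨A, hA⟩
      exact ⟨A, (h3 A.1 y).symm.trans (congrArg Ψ hA)⟩
    · rintro ⟨A, hA⟩
      exact ⟨A, Ψ.injective ((h3 A.1 y).trans hA)⟩
  let H : PolygonSpace d a ≃ₜ PolygonSpace d a' :=
    { Quotient.congr Ψ hrel with
      continuous_toFun := h1.continuous.quotient_map' fun x y => (hrel x y).1
      continuous_invFun := h2.continuous.quotient_map' fun x y h => (hrel _ _).2 (by simpa using h) }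
  refine ⟨H, fun U _ f => ⟨fun hf z hz => (hf (Ψ z) hz).comp (h1 z), fun hf z hz => ?_⟩⟩
  have hH : ∀ w, H (proj d a (Ψ.symm w)) = proj d a' w := fun w =>
    congrArg (proj d a') (Ψ.apply_symm_apply w)
  have h4 := (hf (Ψ.symm z) (by rw [Set.mem_preimage, hH]; exact hz)).comp (h2 z)
  simpa only [Function.comp_apply, hH] using h4

/-! ### Chains as closed polygons -/

section Chains

variable {d : ℕ} [NeZero d] {n : ℕ}

local notation "⟪" x ", " y "⟫" => inner ℝ x y

theorem norm_e₁ (d : ℕ) [NeZero d] : ‖e₁ d‖ = 1 := by simp [e₁]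

/-- The closed polygon obtained from a chain. -/
def closeUp (z : Fin n → EuclideanSpace ℝ (Fin d)) : Fin (n + 1) → EuclideanSpace ℝ (Fin d) :=
  Fin.snoc (α := fun _ => EuclideanSpace ℝ (Fin d)) z (-e₁ d)

@[simp] theorem closeUp_castSucc (z : Fin n → EuclideanSpace ℝ (Fin d)) (i : Fin n) :
    closeUp z i.castSucc = z i := by
  simp [closeUp]

@[simp] theorem closeUp_last (z : Fin n → EuclideanSpace ℝ (Fin d)) :
    closeUp z (Fin.last n) = -e₁ d := by
  simp [closeUp]

theorem closeUp_comp_castSucc {y : Fin (n + 1) → EuclideanSpace ℝ (Fin d)}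
    (hy : y (Fin.last n) = -e₁ d) : closeUp (fun i => y i.castSucc) = y := by
  funext i
  induction i using Fin.lastCases with
  | last => rw [closeUp_last, hy]
  | cast i => rw [closeUp_castSucc]

theorem closeUp_mem_iff {a : Fin (n + 1) → ℝ} {z : Fin n → EuclideanSpace ℝ (Fin d)} :
    closeUp z ∈ closedPolygons (EuclideanSpace ℝ (Fin d)) a ↔ z ∈ chainSpace d a := by
  simp only [closedPolygons, chainSpace, Set.mem_ofPred_eq, Fin.forall_fin_succ', closeUp_castSucc,
    closeUp_last, norm_neg, norm_e₁, and_true, mem_sphere_zero_iff_norm, Fin.sum_univ_castSucc,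
    smul_neg, ← sub_eq_add_neg, sub_eq_zero]

theorem contDiff_closeUp : ContDiff ℝ ω (closeUp (d := d) (n := n)) := by
  refine contDiff_pi.2 fun i => ?_
  induction i using Fin.lastCases with
  | last => simpa only [closeUp_last] using contDiff_const
  | cast i => simpa only [closeUp_castSucc] using contDiff_apply _ _ i

/-! ### Genericity and relabelling of the edges -/

theorem Generic.unlined {a : Fin (n + 1) → ℝ} (ha : Generic a) : Unlined a := by
  have key : ∀ J : Finset (Fin (n + 1)), Fin.last n ∈ J → ∑ i ∈ J, a i ≠ ∑ i ∈ Jᶜ, a i := by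
    intro J hJ h
    -- A half-weight set `J` gives a lined chain. The sign is `-1` on `J` because `J` contains the
    -- last index, whose edge is `-e₁`.
    refine Set.eq_empty_iff_forall_notMem.1 ha
      (fun i => (if i.castSucc ∈ J then (-1 : ℝ) else 1) • e₁ 1)
      (closeUp_mem_iff.1 ⟨fun i => ?_, ?_⟩)
    · induction i using Fin.lastCases with
      | last => rw [closeUp_last, norm_neg, norm_e₁]
      | cast i =>
        rw [closeUp_castSucc, norm_smul, norm_e₁]
        split_ifs <;> simp
    · have h1 : ∀ i, a i • closeUp (fun i : Fin n => (if i.castSucc ∈ J then (-1 : ℝ) else 1) • e₁ 1) i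
          = (if i ∈ J then -a i else a i) • e₁ 1 := by
        intro i
        induction i using Fin.lastCases with
        | last => rw [closeUp_last, if_pos hJ, smul_neg, neg_smul]
        | cast i =>
          rw [closeUp_castSucc, smul_smul]
          split_ifs <;> simp
      simp only [h1]
      rw [← Finset.sum_smul, Finset.sum_ite, Finset.sum_neg_distrib]
      simp only [Finset.filter_mem_eq_inter, Finset.univ_inter]
      rw [h, ← Finset.compl_filter, Finset.filter_mem_eq_inter, Finset.univ_inter, neg_add_cancel,
        zero_smul]
  intro J
  by_cases hJ : Fin.last n ∈ J
  · exact key J hJ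
  · intro h
    exact key Jᶜ (Finset.mem_compl.2 hJ) (by rw [compl_compl, h])

theorem sum_compl_map_perm {ι : Type*} [Fintype ι] [DecidableEq ι] (a : ι → ℝ) (τ : Equiv.Perm ι)
    (J : Finset ι) : ∑ i ∈ (J.map τ.toEmbedding)ᶜ, a i = ∑ i ∈ Jᶜ, a (τ i) := by
  have h : (J.map τ.toEmbedding)ᶜ = Jᶜ.map τ.toEmbedding := by
    ext i
    simp only [Finset.mem_compl, Finset.mem_map_equiv]
  rw [h, Finset.sum_map]
  rfl

theorem Unlined.comp_perm {ι : Type*} [Fintype ι] [DecidableEq ι] {a : ι → ℝ} (ha : Unlined a)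
    (τ : Equiv.Perm ι) : Unlined fun i => a (τ i) := by
  intro J
  have h := ha (J.map τ.toEmbedding)
  rwa [sum_compl_map_perm, Finset.sum_map] at h

theorem closedPolygons_comp_perm_iff {E : Type*} [NormedAddCommGroup E] [InnerProductSpace ℝ E]
    {ι : Type*} [Fintype ι] {a : ι → ℝ} (τ : Equiv.Perm ι) {z : ι → E} :
    (fun i => z (τ i)) ∈ closedPolygons E (fun i => a (τ i)) ↔ z ∈ closedPolygons E a := by
  simp only [closedPolygons, Set.mem_ofPred_eq]
  rw [τ.forall_congr_left, Equiv.sum_comp τ (fun i => a i • z i)]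
  simp

theorem IsShort.subset {a : Fin (n + 1) → ℝ} (ha0 : ∀ i, 0 < a i) {J K : Finset (Fin (n + 1))}
    (hJ : IsShort a J) (hK : K ⊆ J) : IsShort a K :=
  ((Finset.sum_le_sum_of_subset_of_nonneg hK fun i _ _ => (ha0 i).le).trans_lt hJ).trans_le
    (Finset.sum_le_sum_of_subset_of_nonneg (Finset.compl_subset_compl.2 hK) fun i _ _ => (ha0 i).le)

theorem exists_perm_isShort_iff {a a' : Fin (n + 1) → ℝ} (ha0 : ∀ i, 0 < a i)
    (ha0' : ∀ i, 0 < a' i) (f : shortLast a ≃o shortLast a') :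
    ∃ τ : Equiv.Perm (Fin (n + 1)), τ (Fin.last n) = Fin.last n ∧
      ∀ J, Fin.last n ∈ J → (∑ i ∈ J, a i < ∑ i ∈ Jᶜ, a i ↔
        ∑ i ∈ J, a' (τ i) < ∑ i ∈ Jᶜ, a' (τ i)) := by
  obtain ⟨τ, hτ, h⟩ := exists_perm_of_orderIso (m := Fin.last n) (S := shortLast a)
    (T := shortLast a') (fun J hJ => hJ.2)
    (fun J hJ K hK hm => ⟨hJ.1.subset ha0 hK, hm⟩) (fun J hJ => hJ.2)
    (fun J hJ K hK hm => ⟨hJ.1.subset ha0' hK, hm⟩) f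
  refine ⟨τ, hτ, fun J hJ => ?_⟩
  have h1 : IsShort a' (J.map τ.toEmbedding) ↔ ∑ i ∈ J, a' (τ i) < ∑ i ∈ Jᶜ, a' (τ i) := by
    rw [IsShort, sum_compl_map_perm, Finset.sum_map]
    rfl
  rw [← h1]
  have h2 : Fin.last n ∈ J.map τ.toEmbedding := Finset.mem_map.2 ⟨_, hJ, hτ⟩
  exact ⟨fun hs => ((h J hJ).1 ⟨hs, hJ⟩).1, fun hs => ((h J hJ).2 ⟨hs, h2⟩).1⟩

/-- Reindex the closed polygon of a chain, move it to a closed polygon for the weights `b` by a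
Möbius map fixing the pole, reindex again and forget the last edge. -/
def chainMap (b : Fin (n + 1) → ℝ) (ρ σ : Equiv.Perm (Fin (n + 1)))
    (z : Fin n → EuclideanSpace ℝ (Fin d)) (i : Fin n) : EuclideanSpace ℝ (Fin d) :=
  closing (e₁ d) b (fun j => closeUp z (ρ j)) (σ i.castSucc)

theorem closeUp_chainMap (b : Fin (n + 1) → ℝ) {ρ σ : Equiv.Perm (Fin (n + 1))}
    (hρ : ρ (Fin.last n) = Fin.last n) (hσ : σ (Fin.last n) = Fin.last n)
    (z : Fin n → EuclideanSpace ℝ (Fin d)) :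
    closeUp (chainMap b ρ σ z) = fun i => closing (e₁ d) b (fun j => closeUp z (ρ j)) (σ i) :=
  closeUp_comp_castSucc (y := fun i => closing (e₁ d) b (fun j => closeUp z (ρ j)) (σ i)) (by
    rw [hσ]
    exact closing_pole (norm_e₁ d) b (by rw [hρ, closeUp_last]))

theorem smoothAt_chainMap {a b c : Fin (n + 1) → ℝ} {ρ : Equiv.Perm (Fin (n + 1))}
    (σ : Equiv.Perm (Fin (n + 1))) (hb : Unlined b) (hb0 : ∀ i, 0 < b i)
    (hcb : Closable (e₁ d) c b)
    (hac : ∀ z ∈ chainSpace d a,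
      (fun i => closeUp z (ρ i)) ∈ closedPolygons (EuclideanSpace ℝ (Fin d)) c)
    (z : chainSpace d a) : SmoothAt (fun w : chainSpace d a => chainMap b ρ σ w.1) z := by
  obtain ⟨F, hF, hFc⟩ := exists_contDiffAt_eq_closing (norm_e₁ d) hb hb0 hcb (hac z z.2)
  have hg : ContDiff ℝ ω fun (w : Fin n → EuclideanSpace ℝ (Fin d)) (i : Fin (n + 1)) =>
      closeUp w (ρ i) := contDiff_pi.2 fun i => contDiff_pi.1 contDiff_closeUp (ρ i)
  refine SmoothAt.of_contDiffAt
    (F := fun w i => F (fun j => closeUp w (ρ j)) (σ (Fin.castSucc i))) ?_ ?_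
  · exact contDiffAt_pi.2 fun i => contDiffAt_pi.1
      (ContDiffAt.comp z.1 (g := F) hF hg.contDiffAt) (σ i.castSucc)
  · filter_upwards [hg.continuous.continuousAt.eventually hFc] with w hw hwa
    funext i
    rw [hw (hac w hwa)]
    rfl

theorem chainsEquivariantlyDiffeomorphic_of_perm {a a' : Fin (n + 1) → ℝ}
    (ha : Unlined a) (ha0 : ∀ i, 0 < a i) (ha' : Unlined a') (ha0' : ∀ i, 0 < a' i)
    (τ : Equiv.Perm (Fin (n + 1))) (hτ : τ (Fin.last n) = Fin.last n)
    (h : ∀ J, Fin.last n ∈ J → (∑ i ∈ J, a i < ∑ i ∈ Jᶜ, a i ↔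
        ∑ i ∈ J, a' (τ i) < ∑ i ∈ Jᶜ, a' (τ i))) :
    ChainsEquivariantlyDiffeomorphic d a a' := by
  have he := norm_e₁ d
  -- After relabelling, `a` and `b` have the same short sets containing the last index. The Möbius
  -- passage is between `a` and `b`; `τ` only permutes edges.
  set b : Fin (n + 1) → ℝ := fun i => a' (τ i) with hb_def
  have hb : Unlined b := ha'.comp_perm τ
  have hb0 : ∀ i, 0 < b i := fun i => ha0' _
  have hab : Closable (e₁ d) a b := closable_of_short_iff he ha ha0 hb hb0 _ h
  have hba : Closable (e₁ d) b a :=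
    closable_of_short_iff he hb hb0 ha ha0 _ fun J hJ => (h J hJ).symm
  have hτ' : τ.symm (Fin.last n) = Fin.last n := by rw [Equiv.symm_apply_eq, hτ]
  have hm : ∀ z ∈ chainSpace d a, closeUp z ∈ closedPolygons _ a := fun z hz =>
    closeUp_mem_iff.2 hz
  have hm' : ∀ z ∈ chainSpace d a', (fun i => closeUp z (τ i)) ∈ closedPolygons _ b :=
    fun z hz => (closedPolygons_comp_perm_iff τ).2 (closeUp_mem_iff.2 hz)
  have hc := fun z => closeUp_chainMap (d := d) b (ρ := 1) rfl hτ' z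
  have hc' := fun z => closeUp_chainMap (d := d) a (σ := 1) hτ rfl z
  let Ψ : chainSpace d a ≃ chainSpace d a' :=
    { toFun := fun z => ⟨chainMap b 1 τ.symm z.1, by
        rw [← closeUp_mem_iff, ← closedPolygons_comp_perm_iff τ, hc]
        simpa using closing_mem he hab (hm z z.2)⟩
      invFun := fun z => ⟨chainMap a τ 1 z.1, by
        rw [← closeUp_mem_iff, hc']
        exact closing_mem he hba (hm' z z.2)⟩
      left_inv := fun z => by
        refine Subtype.ext (funext fun i => ?_)
        have h1 := congrFun (closing_closing he ha ha0 hab (hm z z.2)) i.castSucc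
        rw [closeUp_castSucc] at h1
        refine Eq.trans ?_ h1
        simp only [chainMap, Equiv.Perm.one_apply]
        rw [hc]
        simp
      right_inv := fun z => by
        refine Subtype.ext (funext fun i => ?_)
        have h1 := congrFun (closing_closing he hb hb0 hba (hm' z z.2)) (τ.symm i.castSucc)
        rw [Equiv.apply_symm_apply, closeUp_castSucc] at h1
        refine Eq.trans ?_ h1
        change closing (e₁ d) b (fun j => closeUp (chainMap a τ 1 z.1) j) _ = _
        rw [hc']
        rfl }
  refine ⟨Ψ, smoothAt_chainMap (ρ := 1) τ.symm hb hb0 hab hm,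
    smoothAt_chainMap 1 ha ha0 hba hm', fun A z => Subtype.ext (funext fun i => ?_)⟩
  have h1 := closing_map he hb hb0 hab (hm z z.2) A.1 A.2 (τ.symm i.castSucc)
  refine Eq.trans ?_ h1
  change closing (e₁ d) b (closeUp fun i => A.1 (z.1 i)) _ = _
  congr 1
  have h2 := closeUp_comp_castSucc (y := fun i => A.1 (closeUp z.1 i)) (by
    rw [closeUp_last, map_neg, show A.1 (e₁ d) = e₁ d from A.2])
  simpa only [closeUp_castSucc] using h2

end Chains

end ChainPolygon

end

theorem mainTheorem4 (n d : ℕ) [NeZero d] (a a' : Fin (n + 1) → ℝ)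
    (ha_pos : ∀ i, 0 < a i) (ha'_pos : ∀ i, 0 < a' i)
    (ha : ChainPolygon.Generic a) (ha' : ChainPolygon.Generic a')
    (hS : Nonempty (ChainPolygon.shortLast a ≃o ChainPolygon.shortLast a')) :
    ChainPolygon.ChainsEquivariantlyDiffeomorphic d a a' ∧
      ChainPolygon.PolygonsDiffeomorphic d a a' := by
  obtain ⟨f⟩ := hS
  obtain ⟨τ, hτ, h⟩ := ChainPolygon.exists_perm_isShort_iff ha_pos ha'_pos f
  have hC : ChainPolygon.ChainsEquivariantlyDiffeomorphic d a a' :=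
    ChainPolygon.chainsEquivariantlyDiffeomorphic_of_perm ha.unlined ha_pos ha'.unlined ha'_pos
      τ hτ h
  exact ⟨hC, hC.polygonsDiffeomorphic⟩
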